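/- Let $n\ge 1$, $r\ge 2$ be integers. Let $\mathcal H(x)$ be the $n\times n$ matrix with $1$'s on the first subdiagonal, $x$ in the upper right corner and zeros elsewhere, let $\mathcal N$ be the upper shift matrix ($\mathcal N_{i,i+1}=1$, other entries $0$), $G=\mathrm{diag}(0,1,\dots,n-1)$, and for $t=(t_1,\dots,t_{rn})\in\mathbb C^{rn}$, $t_0\in\mathbb C$ put $$D(x)=\frac1{nx}\Big(t_0+\sum_{J=1}^{rn}t_J\,\mathcal H(x)^J-G\Big).$$ A polynomial matrix $A(x)$ has times $t$ if, for some $t_0$, there is a formal gauge $Y(x)=Y_0+Y_1x^{-1}+Y_2x^{-2}+\cdots$, $\det Y_0\neq0$, with $Y'=AY-YD$. Let $U\subseteq\mathbb C^{rn}$ be open and let $A(x;t)=A_r(t)x^{r-1}+A_{r-1}(t)x^{r-2}+\cdots+A_1(t)$ be an $n\times n$ polynomial matrix in $x$ whose coefficients are holomorphic functions of $t\in U$, such that for every $t\in U$: 1. (gauge-fixed form) $A_r=\frac1n\sum_{j=0}^{n-1}t_{rn-j}\mathcal N^j$ and $(A_{r-1})_{n1}=\frac1n t_{rn-1}\neq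 0$; 2. $A(\cdot\,;t)$ has times $t$. Let then $Y=\mathbf 1+U_0+\mathcal O(x^{-1})$, $U_0$ strictly upper triangular and constant in $x$, be the formal gauge normalized in this way; 3. (isomonodromic deformation) for $J=1,\dots,rn$, $$\partial_{t_J}A=\partial_x\mathcal T_J+[\mathcal T_J,A],\qquad \mathcal T_J=\frac1J\big(Y\mathcal H^JY^{-1}\big)_+,$$ where $(\ )_+$ denotes the part with nonnegative powers of $x$. Put $x=q^n$ and let $y$ be the eigenvalue of $A(x;t)$ that has at $q=\infty$ the Puiseux expansion $$y=\frac1n\sum_{J=1}^{rn}t_Jq^{J-n}+\mathcal O(q^{-n}).$$ Let $\zeta_\infty$ be the point of the spectral curve over $x=\infty$, with local parameter $1/q$, and for $K=1,\dots,rn$ set $$H_K=\frac1K\mathop{\mathrm{res}}_{\zeta_\infty}x^{K/n}\,y\,dx ,$$ where the residue is normalized by $\mathop{\mathrm{res}}_{\zeta_\infty}dq/q=1$; that is, $\frac1nKH_K$ is the coefficient of $q^{-n-K}$ in $y$. Then the $H_K$ are holomorphic on $U$, and the differential $$\sum_{K=1}^{rn}H_K\,dt_K$$ is closed on $U$: $\partial_{t_J}H_K=\partial_{t_K}H_J$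 for all $J,K$. -/

import Mathlib

noncomputable section

namespace PolyConn

open scoped LaurentSeries

/-! ### Laurent series at infinity

`LaurentSeries ℂ` is read as the field of formal Laurent series in `1/x` (coefficient of index `m` =
coefficient of `x^(-m)`), and for the spectral curve as the field of formal Laurent series in `1/q`,
where `q` is a fixed `n`-th root of `x`. -/

/-- The variable `x`, as a Laurent series in `1/x`. -/
def X : LaurentSeries ℂ := HahnSeries.single (-1) 1

/-- The derivation `d/dx` of Laurent series in `s = 1/x`, that is `-s² d/ds`. -/
def ddx (f : LaurentSeries ℂ) : LaurentSeries ℂ :=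
  -(HahnSeries.single 2 1 * LaurentSeries.derivative ℂ f)

/-- The polynomial part `(f)₊` (projection onto the nonnegative powers of `x`). -/
def polyPart (f : LaurentSeries ℂ) : Polynomial ℂ :=
  ∑ k ∈ Finset.range ((-f.order).toNat + 1), Polynomial.monomial k (f.coeff (-(k : ℤ)))

/-- A matrix polynomial in `x` as a matrix of Laurent series in `1/x`. -/
def atInfinity {n : ℕ} (A : Matrix (Fin n) (Fin n) (Polynomial ℂ)) :
    Matrix (Fin n) (Fin n) (LaurentSeries ℂ) :=
  A.map (Polynomial.aeval X)

/-! ### The bare connection -/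

/-- The matrix `𝓗(x)`: ones on the first subdiagonal and `x` in the upper right corner
(for `n = 1` it is the `1 × 1` matrix `x`). -/
def bareH (n : ℕ) : Matrix (Fin n) (Fin n) (LaurentSeries ℂ) :=
  Matrix.of fun i j =>
    if (i : ℕ) = (j : ℕ) + 1 then 1
    else if (i : ℕ) = 0 ∧ (j : ℕ) + 1 = n then X
    else 0

/-- `G = diag(0, 1, …, n-1)`. -/
def bareG (n : ℕ) : Matrix (Fin n) (Fin n) (LaurentSeries ℂ) :=
  Matrix.diagonal fun i => ((i : ℕ) : LaurentSeries ℂ)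

/-- The times `(t_1, …, t_N)` are stored as a vector indexed by `Fin N`, the entry of index `k`
being `t_{k+1}`. `time t J` is `t_J`; it is `0` for `J = 0` and for `J > N`. -/
def time {N : ℕ} (t : Fin N → ℂ) (J : ℕ) : ℂ :=
  if h : 1 ≤ J ∧ J ≤ N then t ⟨J - 1, by omega⟩ else 0

/-- The bare connection matrix
`D(x) = (1/(n x)) (t_0 + ∑_{J=1}^{N} t_J 𝓗(x)^J - G)`. -/
def bareD (n : ℕ) {N : ℕ} (t₀ : ℂ) (t : Fin N → ℂ) : Matrix (Fin n) (Fin n) (LaurentSeries ℂ) :=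
  ((n : LaurentSeries ℂ) * X)⁻¹ •
    (t₀ • (1 : Matrix (Fin n) (Fin n) (LaurentSeries ℂ))
      + ∑ J ∈ Finset.Icc 1 N, time t J • bareH n ^ J - bareG n)

/-! ### Formal gauges, times, deformation matrices -/

/-- The coefficient of `x^0` of a matrix of Laurent series in `1/x`. -/
def constCoeff {n : ℕ} (Y : Matrix (Fin n) (Fin n) (LaurentSeries ℂ)) :
    Matrix (Fin n) (Fin n) ℂ :=
  Y.map fun f => f.coeff 0

/-- `Y` is a formal gauge `Y = Y_0 + Y_1 x⁻¹ + Y_2 x⁻² + ⋯` with `det Y_0 ≠ 0`, taking the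
connection `∂_x - A` to the bare connection `∂_x - D` with parameters `t_0, t`, that is
`Y' = A Y - Y D`. Equivalently, `Y Ψ` with
`Ψ = exp (∑_J (t_J / J) 𝓗^J) x^((t_0 - G)/n)` is a formal solution of `Ψ' = A Ψ`. -/
structure IsFormalGauge {n N : ℕ} (A : Matrix (Fin n) (Fin n) (Polynomial ℂ)) (t₀ : ℂ)
    (t : Fin N → ℂ) (Y : Matrix (Fin n) (Fin n) (LaurentSeries ℂ)) : Prop where
  integral : ∀ (a b : Fin n) (m : ℤ), m < 0 → (Y a b).coeff m = 0
  det_ne_zero : (constCoeff Y).det ≠ 0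
  gauge : Y.map ddx = atInfinity A * Y - Y * bareD n t₀ t

/-- `t` is the vector of times of `A`: the parameters `t_1, …, t_N` of a bare connection to which
`∂_x - A` is formally gauge equivalent at infinity (for some exponent `t_0`). -/
def HasTimes {n N : ℕ} (A : Matrix (Fin n) (Fin n) (Polynomial ℂ)) (t : Fin N → ℂ) : Prop :=
  ∃ (t₀ : ℂ) (Y : Matrix (Fin n) (Fin n) (LaurentSeries ℂ)), IsFormalGauge A t₀ t Y

/-- The constant coefficient of `Y` is `1 + U` with `U` strictly upper triangular. -/
def IsNormalized {n : ℕ} (Y : Matrix (Fin n) (Fin n) (LaurentSeries ℂ)) : Prop :=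
  ∀ a b : Fin n, b ≤ a → (constCoeff Y) a b = (1 : Matrix (Fin n) (Fin n) ℂ) a b

/-- The normalized formal gauge `Y = 1 + U + O(x⁻¹)` of a connection `A` with times `t`. -/
def formalGauge {n N : ℕ} (A : Matrix (Fin n) (Fin n) (Polynomial ℂ)) (t : Fin N → ℂ) :
    Matrix (Fin n) (Fin n) (LaurentSeries ℂ) :=
  Classical.epsilon fun Y => ∃ t₀ : ℂ, IsFormalGauge A t₀ t Y ∧ IsNormalized Y

/-- The deformation matrix `𝓣_J(x) = (1/J) (Y 𝓗^J Y⁻¹)₊`. -/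
def deform {n N : ℕ} (A : Matrix (Fin n) (Fin n) (Polynomial ℂ)) (t : Fin N → ℂ) (J : ℕ) :
    Matrix (Fin n) (Fin n) (Polynomial ℂ) :=
  (1 / (J : ℂ)) • ((formalGauge A t * bareH n ^ J * (formalGauge A t)⁻¹).map polyPart)

/-- `A` is a polynomial of degree `r - 1`, `A = A_r x^(r-1) + A_{r-1} x^(r-2) + ⋯`, in the
gauge-fixed form with respect to `t = (t_1, …, t_{rn})`: the leading coefficient is
`A_r = (1/n) ∑_{j=0}^{n-1} t_{rn-j} 𝓝^j`, `𝓝` the upper shift matrix, and the lower left entry of the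
subleading coefficient `A_{r-1}` is `t_{rn-1}/n`, which is nonzero. -/
structure IsGaugeFixed {n : ℕ} (r : ℕ) (t : Fin (r * n) → ℂ)
    (A : Matrix (Fin n) (Fin n) (Polynomial ℂ)) : Prop where
  degree : ∀ (a b : Fin n) (m : ℕ), r ≤ m → (A a b).coeff m = 0
  leading : ∀ a b : Fin n, (A a b).coeff (r - 1) =
    if a ≤ b then time t (r * n - ((b : ℕ) - (a : ℕ))) / n else 0
  subleading : ∀ a b : Fin n, (a : ℕ) + 1 = n → (b : ℕ) = 0 →
    (A a b).coeff (r - 2) = time t (r * n - 1) / n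
  lidskii : time t (r * n - 1) ≠ 0

/-- A family `A(x; t)` of polynomial connections over a set `U` of times is an isomonodromic
deformation: each `A(x; t)` is in gauge-fixed form, has times `t`, its coefficients depend
holomorphically on `t`, and the zero curvature equations
`∂A/∂t_J = ∂𝓣_J/∂x + [𝓣_J, A]` hold for `J = 1, …, rn`. -/
structure IsDeformation (n r : ℕ) (U : Set (Fin (r * n) → ℂ))
    (A : (Fin (r * n) → ℂ) → Matrix (Fin n) (Fin n) (Polynomial ℂ)) : Prop where
  gaugeFixed : ∀ t ∈ U, IsGaugeFixed r t (A t)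
  hasTimes : ∀ t ∈ U, HasTimes (A t) t
  holomorphic : ∀ (a b : Fin n) (m : ℕ), DifferentiableOn ℂ (fun t => (A t a b).coeff m) U
  zeroCurvature : ∀ t ∈ U, ∀ (k : Fin (r * n)) (a b : Fin n) (m : ℕ),
    fderiv ℂ (fun s => (A s a b).coeff m) t (Pi.single k 1) =
      (((deform (A t) t (k + 1)).map Polynomial.derivative
        + (deform (A t) t (k + 1) * A t - A t * deform (A t) t (k + 1))) a b).coeff m

/-! ### The spectral curve at infinity -/

/-- `q^e` as a Laurent series in `1/q`. -/
def qPow (e : ℤ) : LaurentSeries ℂ := HahnSeries.single (-e) 1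

/-- `y` is an eigenvalue of `A(x)`, `x = q^n`, with expansion
`y = (1/n) ∑_{J=1}^{N} t_J q^(J-n) + O(q^(-n))`. -/
def IsSpectralBranch {n N : ℕ} (A : Matrix (Fin n) (Fin n) (Polynomial ℂ)) (t : Fin N → ℂ)
    (y : LaurentSeries ℂ) : Prop :=
  Polynomial.eval y (A.map (Polynomial.aeval (qPow n))).charpoly = 0 ∧
    ∀ J : ℕ, 1 ≤ J → y.coeff ((n : ℤ) - J) = time t J / n

/-- The branch at infinity of the eigenvalue `y` of `A(x)`, in the local parameter `1/q`. -/
def spectralBranch {n N : ℕ} (A : Matrix (Fin n) (Fin n) (Polynomial ℂ)) (t : Fin N → ℂ) :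
    LaurentSeries ℂ :=
  Classical.epsilon fun y => IsSpectralBranch A t y

/-- The residue at the point `ζ_∞` over `x = ∞` of the differential `f dx = f n q^(n-1) dq`,
normalized by `res dq/q = 1` (a small circle around `ζ_∞` is oriented counterclockwise in `q`). -/
def residue (n : ℕ) (f : LaurentSeries ℂ) : ℂ :=
  (f * ((n : LaurentSeries ℂ) * qPow ((n : ℤ) - 1))).coeff 1

/-- `H_K = (1/K) res_{ζ_∞} x^(K/n) y dx`. -/
def hamiltonian {n N : ℕ} (A : Matrix (Fin n) (Fin n) (Polynomial ℂ)) (t : Fin N → ℂ) (K : ℕ) :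
    ℂ :=
  (1 / (K : ℂ)) * residue n (qPow K * spectralBranch A t)

/-- The differential `∑_{K=1}^{N} H_K dt_K` on the space of times. -/
def tauForm {n N : ℕ} (A : (Fin N → ℂ) → Matrix (Fin n) (Fin n) (Polynomial ℂ))
    (t : Fin N → ℂ) : (Fin N → ℂ) →L[ℂ] ℂ :=
  ∑ k : Fin N, hamiltonian (A t) t (k + 1) • ContinuousLinearMap.proj (R := ℂ) (φ := fun _ => ℂ) k

/-- A differential 1-form `ω` is closed on the open set `U`: it is (complex) differentiable there and
its exterior derivative `dω(u, v) = (D_u ω)(v) - (D_v ω)(u)` vanishes. -/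
def IsClosedOn {N : ℕ} (ω : (Fin N → ℂ) → ((Fin N → ℂ) →L[ℂ] ℂ)) (U : Set (Fin N → ℂ)) : Prop :=
  DifferentiableOn ℂ ω U ∧ ∀ t ∈ U, ∀ u v : Fin N → ℂ, fderiv ℂ ω t u v - fderiv ℂ ω t v u = 0

end PolyConn

end

/-! Put `x = q^n` and send a matrix `M` over Laurent series in `1/x` to the row `(1, …, 1) S M S⁻¹`,
`S = diag(1, q, …, q^(n-1))`. This is a bijection onto rows of Laurent series in `1/q` (`colSum`,
`unshear`). Left multiplication by `𝓗` becomes multiplication by `q`; right multiplication by `𝓗`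
becomes `q` times a cyclic shift of the components.

In gauge-fixed form the sheared `A` is a scalar plus a nonzero multiple of the cyclic permutation
matrix plus lower order. It therefore has a row eigenvector `l = (1, …, 1) + O(1/q)`, found by
recursion on coefficients with division only by `n` and `t_{rn-1}/n`. Run over the ring of
holomorphic functions on `U`, the recursion makes `l` and the eigenvalue `y` holomorphic in `t`. The
matrix `Z` with row `l` satisfies `Z A Z⁻¹ = y(𝓗)`.

The flow is defined with the formal gauge `Y`, not with `Z`. But `W = Z Y` satisfies `y(𝓗) W = W D +
Z Y'`, where the non-commuting terms are `O(q^(-n))`. This forces `W` to commute with `𝓗` to such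
high order that `Z⁻¹𝓗^J Z` and `Y𝓗^J Y⁻¹` differ by `O(1)` for `J ≤ rn` (`IsEigenrow.rigidity`). The
polynomial parts then differ by constants, so `∂_x 𝓣_J` may be computed with `M_J = Z⁻¹𝓗^J Z`
(`IsEigenrow.ddx_deform`).

First-order perturbation theory gives `∂_{t_J} H_K = (1/K) res tr(M_K ∂_{t_J} A)`
(`IsEigenrow.trace_variation`). In the zero curvature equation the commutator drops out since `M_K`
commutes with `A`, leaving `(1/(JK)) res tr(M_K d(M_J)₊)`. Antisymmetrizing in `J, K` turns this
into `res tr(M_K dM_J)` (`residue_trace_skew`). Conjugation invariance equates that with `res tr(𝓗^K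
d𝓗^J)`, which vanishes because the entries are polynomials. -/

noncomputable section

namespace PolyConn

/-! ### Laurent series with vanishing low coefficients -/

/-- The coefficients of `f` of index less than `N` vanish. -/
def VanishBelow {k : Type*} [Zero k] (N : ℤ) (f : LaurentSeries k) : Prop :=
  ∀ m < N, f.coeff m = 0

section VanishBelow

variable {k : Type*} [CommRing k] {a b : ℤ} {f g : LaurentSeries k}

theorem exists_vanishBelow (f : LaurentSeries k) : ∃ N, VanishBelow N f :=
  ⟨f.order, fun _ hm => HahnSeries.coeff_eq_zero_of_lt_order hm⟩

theorem coeff_mul_eq_sum (hf : VanishBelow a f) (hg : VanishBelow b g) (m : ℤ) :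
    (f * g).coeff m = ∑ i ∈ Finset.Icc a (m - b), f.coeff i * g.coeff (m - i) := by
  rw [HahnSeries.coeff_mul]
  refine Finset.sum_of_injOn (fun ij => ij.1) ?_ ?_ ?_ ?_
  · rintro ⟨i, j⟩ h ⟨i', j'⟩ h' e
    simp only [Finset.mem_coe, Finset.mem_antidiagonal] at h h'
    simp only at e
    ext <;> simp <;> omega
  · rintro ⟨i, j⟩ h
    simp only [Finset.mem_coe, Finset.mem_antidiagonal, HahnSeries.mem_support] at h
    simp only [Finset.coe_Icc, Set.mem_Icc]
    constructor
    · by_contra hi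
      exact h.1 (hf i (by omega))
    · by_contra hi
      exact h.2.1 (hg j (by omega))
  · intro i _ hi
    by_contra hne
    refine hi ⟨(i, m - i), ?_, rfl⟩
    simp only [Finset.mem_coe, Finset.mem_antidiagonal, HahnSeries.mem_support]
    exact ⟨left_ne_zero_of_mul hne, right_ne_zero_of_mul hne, by omega⟩
  · rintro ⟨i, j⟩ h
    simp only [Finset.mem_antidiagonal] at h
    simp only
    rw [show m - i = j by omega]

theorem VanishBelow.mono (hf : VanishBelow a f) (h : b ≤ a) : VanishBelow b f :=
  fun m hm => hf m (by omega)

theorem vanishBelow_zero : VanishBelow a (0 : LaurentSeries k) := fun _ _ => rfl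

theorem VanishBelow.add (hf : VanishBelow a f) (hg : VanishBelow a g) : VanishBelow a (f + g) :=
  fun m hm => by simp [hf m hm, hg m hm]

theorem VanishBelow.sub (hf : VanishBelow a f) (hg : VanishBelow a g) : VanishBelow a (f - g) :=
  fun m hm => by simp [hf m hm, hg m hm]

theorem VanishBelow.sum {ι : Type*} {s : Finset ι} {f : ι → LaurentSeries k}
    (hf : ∀ i ∈ s, VanishBelow a (f i)) : VanishBelow a (∑ i ∈ s, f i) :=
  fun m hm => by
    rw [HahnSeries.coeff_sum]
    exact Finset.sum_eq_zero fun i hi => hf i hi m hm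

theorem vanishBelow_single (c : k) (h : b ≤ a) : VanishBelow b (HahnSeries.single a c) :=
  fun m hm => HahnSeries.coeff_single_of_ne (by omega)

theorem VanishBelow.mul (hf : VanishBelow a f) (hg : VanishBelow b g) :
    VanishBelow (a + b) (f * g) := fun m hm => by
  rw [coeff_mul_eq_sum hf hg, Finset.Icc_eq_empty (by omega), Finset.sum_empty]

theorem coeff_mul_lowest (hf : VanishBelow a f) (hg : VanishBelow b g) :
    (f * g).coeff (a + b) = f.coeff a * g.coeff b := by
  rw [coeff_mul_eq_sum hf hg, show a + b - b = a by ring, Finset.Icc_self, Finset.sum_singleton,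
    show a + b - a = b by ring]

theorem coeff_mul_second (hf : VanishBelow a f) (hg : VanishBelow b g) :
    (f * g).coeff (a + b + 1) = f.coeff a * g.coeff (b + 1) + f.coeff (a + 1) * g.coeff b := by
  rw [coeff_mul_eq_sum hf hg, show Finset.Icc a (a + b + 1 - b) = {a, a + 1} by ext; simp; omega,
    Finset.sum_pair (by omega), show a + b + 1 - a = b + 1 by ring,
    show a + b + 1 - (a + 1) = b by ring]

theorem coeff_single_mul' (e : ℤ) (c : k) (f : LaurentSeries k) (m : ℤ) :
    (HahnSeries.single e c * f).coeff m = c * f.coeff (m - e) :=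
  HahnSeries.coeff_single_mul

theorem VanishBelow.single_mul (hf : VanishBelow a f) (e : ℤ) (c : k) :
    VanishBelow (e + a) (HahnSeries.single e c * f) := fun m hm => by
  rw [coeff_single_mul', hf _ (by omega), mul_zero]

end VanishBelow

/-! ### Series in `1/x` as series in `1/q`, `x = q ^ n` -/

/-- The substitution `x = q ^ n`. -/
def expandHom (n : ℕ) [NeZero n] : LaurentSeries ℂ →+* LaurentSeries ℂ :=
  HahnSeries.embDomainRingHom (AddMonoidHom.mulLeft (n : ℤ))
    (fun a b h => by
      have := NeZero.ne n
      simpa [this] using h)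
    (fun a b => by
      have : (0 : ℤ) < n := by exact_mod_cast Nat.pos_of_ne_zero (NeZero.ne n)
      simpa using mul_le_mul_iff_right₀ this)

section Expand

variable (n : ℕ) [NeZero n]

theorem coeff_expandHom_mul (f : LaurentSeries ℂ) (m : ℤ) :
    (expandHom n f).coeff (n * m) = f.coeff m := by
  exact HahnSeries.embDomain_coeff (a := m)

theorem coeff_expandHom_of_not_dvd (f : LaurentSeries ℂ) {m : ℤ} (h : ¬ (n : ℤ) ∣ m) :
    (expandHom n f).coeff m = 0 := by
  refine HahnSeries.embDomain_of_notMem_range ?_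
  rintro ⟨c, hc⟩
  exact h ⟨c, hc.symm⟩

theorem expandHom_single (m : ℤ) (c : ℂ) :
    expandHom n (HahnSeries.single m c) = HahnSeries.single (n * m) c := by
  exact HahnSeries.embDomain_single

theorem expandHom_C (c : ℂ) : expandHom n (HahnSeries.C c) = HahnSeries.C c := by
  rw [HahnSeries.C_apply, expandHom_single, mul_zero]

theorem algebraMap_eq_C (c : ℂ) : algebraMap ℂ (LaurentSeries ℂ) c = HahnSeries.C c :=
  HahnSeries.ofPowerSeries_C c

theorem expandHom_aeval (p : Polynomial ℂ) :
    expandHom n (Polynomial.aeval X p) = Polynomial.aeval (qPow n) p := by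
  rw [Polynomial.aeval_def, Polynomial.aeval_def, Polynomial.hom_eval₂]
  congr 1
  · ext1 c
    rw [RingHom.comp_apply, algebraMap_eq_C, expandHom_C]
  · rw [X, qPow, expandHom_single, mul_neg_one]

end Expand

/-- The matrix `S M(q ^ n) S⁻¹`, `S = diag(1, q, …, q ^ (n-1))`. -/
def shear {n : ℕ} [NeZero n] (M : Matrix (Fin n) (Fin n) (LaurentSeries ℂ)) :
    Matrix (Fin n) (Fin n) (LaurentSeries ℂ) :=
  Matrix.of fun i j => HahnSeries.single ((j : ℤ) - i) 1 * expandHom n (M i j)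

/-- The column sums of the sheared matrix. -/
def colSum {n : ℕ} [NeZero n] (M : Matrix (Fin n) (Fin n) (LaurentSeries ℂ)) :
    Fin n → LaurentSeries ℂ :=
  fun j => ∑ i, shear M i j

/-- The matrix with prescribed column sums after shearing. -/
def unshear {n : ℕ} [NeZero n] (u : Fin n → LaurentSeries ℂ) :
    Matrix (Fin n) (Fin n) (LaurentSeries ℂ) :=
  Matrix.of fun i j => HahnSeries.ofSuppBddBelow (fun k => (u j).coeff (n * k + j - i)) <| by
    obtain ⟨N, hN⟩ := exists_vanishBelow (u j)
    refine ⟨-|N| - n, fun k hk => ?_⟩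
    by_contra hlt
    refine hk (hN _ ?_)
    have h1 : (1 : ℤ) ≤ n := by exact_mod_cast Nat.pos_of_ne_zero (NeZero.ne n)
    have h2 : ((j : ℕ) : ℤ) < n := by exact_mod_cast j.2
    have h3 : -|N| ≤ N := neg_abs_le N
    have h4 : 0 ≤ |N| := abs_nonneg N
    have h5 : (0 : ℤ) ≤ ((i : ℕ) : ℤ) := by positivity
    have h6 : k ≤ -|N| - n - 1 := by omega
    nlinarith

/-! ### Matrices over series in `1/x` as row vectors over series in `1/q`. -/

section Shear

variable {n : ℕ} [NeZero n]

local notation "Mat" => Matrix (Fin n) (Fin n) (LaurentSeries ℂ)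

/-- Division with remainder by `n`. Together with `index_unique` it says that for fixed `j` each
exponent of `1/q` comes from exactly one pair (row, exponent of `1/x`); hence the column sums of a
sheared matrix lose no information. -/
theorem exists_index (j : Fin n) (m : ℤ) : ∃ (i : Fin n) (k : ℤ), m = n * k + j - i := by
  have hn : (n : ℤ) ≠ 0 := by exact_mod_cast NeZero.ne n
  have h0 := Int.emod_nonneg (j - m : ℤ) hn
  have h1 := Int.emod_lt_of_pos (j - m : ℤ) (b := n) (by have := NeZero.ne n; omega)
  refine ⟨⟨((j - m : ℤ) % n).toNat, by omega⟩, -((j - m : ℤ) / n), ?_⟩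
  have := Int.mul_ediv_add_emod (j - m : ℤ) n
  simp only [Int.toNat_of_nonneg h0]
  linarith

omit [NeZero n] in
theorem index_unique {i i' : Fin n} {j k k' : ℤ} (h : n * k + j - i = n * k' + j - (i' : ℤ)) :
    i = i' ∧ k = k' := by
  have h1 := i.2
  have h2 := i'.2
  have hk : k = k' := by
    have e : (n : ℤ) * (k - k') = i - i' := by linarith
    rcases lt_trichotomy (k - k') 0 with hlt | h0 | hgt
    · nlinarith
    · omega
    · nlinarith
  subst hk
  exact ⟨by ext; omega, rfl⟩

theorem coeff_shear (M : Mat) (i j : Fin n) (k : ℤ) :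
    (shear M i j).coeff (n * k + j - i) = (M i j).coeff k := by
  rw [shear, Matrix.of_apply, coeff_single_mul', one_mul,
    show (n : ℤ) * k + j - i - (j - i) = n * k by ring, coeff_expandHom_mul]

theorem coeff_shear_of_ne (M : Mat) {i i' : Fin n} (h : i' ≠ i) (j : Fin n) (k : ℤ) :
    (shear M i' j).coeff (n * k + j - i) = 0 := by
  rw [shear, Matrix.of_apply, coeff_single_mul', one_mul, coeff_expandHom_of_not_dvd]
  rintro ⟨c, hc⟩
  exact h (index_unique (j := j) (k := k + c - k) (k' := k) (by linarith)).1

theorem coeff_colSum (M : Mat) (i j : Fin n) (k : ℤ) :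
    (colSum M j).coeff (n * k + j - i) = (M i j).coeff k := by
  rw [colSum, HahnSeries.coeff_sum, Finset.sum_eq_single i, coeff_shear]
  · intro b _ hb
    exact coeff_shear_of_ne M hb j k
  · simp

theorem colSum_injective : Function.Injective (colSum : Mat → _) := by
  intro M M' h
  ext i j k
  rw [← coeff_colSum, h, coeff_colSum]

theorem coeff_unshear (u : Fin n → LaurentSeries ℂ) (i j : Fin n) (k : ℤ) :
    (unshear u i j).coeff k = (u j).coeff (n * k + j - i) := by
  rfl

theorem colSum_unshear (u : Fin n → LaurentSeries ℂ) : colSum (unshear u) = u := by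
  ext j m
  obtain ⟨i, k, rfl⟩ := exists_index j m
  rw [coeff_colSum, coeff_unshear]

theorem shear_mul (M M' : Mat) : shear (M * M') = shear M * shear M' := by
  ext1 i j
  simp only [shear, Matrix.of_apply, Matrix.mul_apply, map_sum, map_mul, Finset.mul_sum]
  refine Finset.sum_congr rfl fun l _ => ?_
  rw [mul_mul_mul_comm, HahnSeries.single_mul_single, mul_one]
  congr 3
  ring

theorem shear_sub (M M' : Mat) : shear (M - M') = shear M - shear M' := by
  ext1 i j
  simp [shear, mul_sub]

theorem shear_add (M M' : Mat) : shear (M + M') = shear M + shear M' := by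
  ext1 i j
  simp [shear, mul_add]

theorem shear_one : shear (1 : Mat) = 1 := by
  ext1 i j
  rcases eq_or_ne i j with rfl | h
  · simp [shear]
  · simp [shear, h]

theorem colSum_sub (M M' : Mat) : colSum (M - M') = colSum M - colSum M' := by
  ext1 j
  simp [colSum, shear_sub]

theorem colSum_add (M M' : Mat) : colSum (M + M') = colSum M + colSum M' := by
  ext1 j
  simp [colSum, shear_add, Finset.sum_add_distrib]

theorem colSum_eq_vecMul (M : Mat) : colSum M = Matrix.vecMul 1 (shear M) := by
  ext1 j
  simp [colSum, Matrix.vecMul, dotProduct]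

theorem colSum_mul (M M' : Mat) : colSum (M * M') = Matrix.vecMul (colSum M) (shear M') := by
  rw [colSum_eq_vecMul, colSum_eq_vecMul, shear_mul, Matrix.vecMul_vecMul]

/-- A sheared matrix vanishes to the order to which its column sums vanish. -/
theorem vanishBelow_shear {M : Mat} {a : ℤ} (h : ∀ j, VanishBelow a (colSum M j)) (i j : Fin n) :
    VanishBelow a (shear M i j) := by
  intro m hm
  obtain ⟨i', k, rfl⟩ := exists_index j m
  rcases eq_or_ne i i' with rfl | hi
  · rw [coeff_shear, ← coeff_colSum]
    exact h j _ hm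
  · exact coeff_shear_of_ne M hi j k

theorem vanishBelow_colSum {M : Mat} {a : ℤ} {j : Fin n} (h : ∀ i, VanishBelow a (shear M i j)) :
    VanishBelow a (colSum M j) :=
  VanishBelow.sum fun i _ => h i

/-- The matrix of multiplication by a series in `q`; it maps `q` to `bareH`. -/
def mulMat (n : ℕ) [NeZero n] (f : LaurentSeries ℂ) : Matrix (Fin n) (Fin n) (LaurentSeries ℂ) :=
  unshear fun _ => f

/-- The column sums of `mulMat n f` all equal `f`, so `(1, …, 1)` is a left eigenvector of its
shear. Consequently `mulMat n` is multiplicative and plays the role of `f(q) ↦ f(𝓗)`. -/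
theorem colSum_mulMat_mul (f : LaurentSeries ℂ) (M : Mat) :
    colSum (mulMat n f * M) = f • colSum M := by
  rw [colSum_mul, mulMat, colSum_unshear]
  ext1 j
  simp [Matrix.vecMul, dotProduct, colSum, Finset.mul_sum]

theorem mulMat_mul (f g : LaurentSeries ℂ) : mulMat n (f * g) = mulMat n f * mulMat n g := by
  apply colSum_injective
  rw [colSum_mulMat_mul, mulMat, mulMat, colSum_unshear, colSum_unshear]
  rfl

theorem mulMat_one : mulMat n 1 = 1 := by
  apply colSum_injective
  rw [mulMat, colSum_unshear, colSum_eq_vecMul, shear_one, Matrix.vecMul_one]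
  rfl

theorem coeff_mulMat (f : LaurentSeries ℂ) (i j : Fin n) (k : ℤ) :
    (mulMat n f i j).coeff k = f.coeff (n * k + j - i) := rfl

theorem bareH_eq_mulMat : bareH n = mulMat n (qPow 1) := by
  ext i j k
  have hi := i.2
  have hj := j.2
  rw [coeff_mulMat, qPow, HahnSeries.coeff_single, bareH, Matrix.of_apply]
  have key : (n * k + j - i = -(1 : ℤ)) ↔ ((i : ℕ) = j + 1 ∧ k = 0) ∨
      (((i : ℕ) = 0 ∧ (j : ℕ) + 1 = n) ∧ k = -1) := by
    constructor
    · intro e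
      rcases lt_trichotomy k 0 with hlt | rfl | hgt
      · have : k = -1 := by nlinarith
        subst this
        omega
      · omega
      · nlinarith
    · rintro (⟨h, rfl⟩ | ⟨⟨h, h'⟩, rfl⟩) <;> omega
  simp only [key]
  split_ifs <;>
    simp only [HahnSeries.coeff_one, X, HahnSeries.coeff_single, HahnSeries.coeff_zero] <;>
    first
    | rw [if_pos (by omega)]
    | rw [if_neg (by omega)]
    | omega

theorem qPow_mul (a b : ℤ) : qPow a * qPow b = qPow (a + b) := by
  rw [qPow, qPow, qPow, HahnSeries.single_mul_single, mul_one]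
  congr 2
  ring

theorem bareH_pow_eq_mulMat (J : ℕ) : bareH n ^ J = mulMat n (qPow J) := by
  induction J with
  | zero => exact mulMat_one.symm
  | succ J ih =>
    rw [pow_succ, ih, bareH_eq_mulMat, ← mulMat_mul, qPow_mul]
    push_cast
    rfl

theorem coeff_trace_mulMat (f : LaurentSeries ℂ) (k : ℤ) :
    ((mulMat n f).trace).coeff k = n * f.coeff (n * k) := by
  simp [Matrix.trace, HahnSeries.coeff_sum, coeff_mulMat]

theorem shear_bareH (i j : Fin n) :
    shear (bareH n) i j = if i = j + Fin.ofNat n 1 then qPow 1 else 0 := by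
  have hi := i.2
  have hj := j.2
  have key : i = j + Fin.ofNat n 1 ↔ (i : ℕ) = j + 1 ∨ ((i : ℕ) = 0 ∧ (j : ℕ) + 1 = n) := by
    rw [Fin.ext_iff, Fin.val_add, Fin.val_ofNat, Nat.add_mod_mod]
    rcases lt_or_eq_of_le (Nat.succ_le_of_lt hj) with h | h
    · rw [Nat.mod_eq_of_lt h]
      omega
    · rw [show (j : ℕ) + 1 = n from h, Nat.mod_self]
      omega
  simp only [key, shear, bareH, Matrix.of_apply]
  split_ifs with h1 h2 h3 h3 h3
  · rw [(expandHom n).map_one, mul_one, qPow, h1]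
    congr 2
    push_cast
    ring
  · omega
  · rw [X, expandHom_single, HahnSeries.single_mul_single, mul_one, qPow]
    congr 2
    omega
  · omega
  · omega
  · rw [map_zero, mul_zero]

/-- The column sums of `M 𝓗 ^ J`. -/
theorem colSum_mul_bareH_pow (M : Mat) (J : ℕ) (j : Fin n) :
    colSum (M * bareH n ^ J) j = qPow J * colSum M (j + Fin.ofNat n J) := by
  induction J generalizing j with
  | zero =>
    rw [pow_zero, mul_one, Nat.cast_zero, qPow, neg_zero, HahnSeries.single_zero_one, one_mul,
      show Fin.ofNat n 0 = 0 by ext; simp, add_zero]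
  | succ J ih =>
    rw [pow_succ, ← mul_assoc, colSum_mul]
    simp only [Matrix.vecMul, dotProduct, shear_bareH, mul_ite, mul_zero, Finset.sum_ite_eq',
      Finset.mem_univ, if_true]
    rw [ih, mul_right_comm, qPow_mul, Nat.cast_succ]
    congr 2
    ext
    simp only [Fin.val_add, Fin.val_ofNat, Nat.add_mod_mod, Nat.mod_add_mod]
    congr 1
    ring

end Shear

/-! ### Row eigenvectors of matrices with a cyclic leading part -/

/-- Course-of-values recursion. The step receives a total function `h` guaranteed to agree with the
sequence only up to index `m`; the application must check that nothing later is read. -/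
theorem exists_seq_of_step {α : Type*} (a₀ : α) (step : ℕ → (ℕ → α) → α) :
    ∃ f : ℕ → α, f 0 = a₀ ∧ ∀ m, ∃ h : ℕ → α, (∀ p ≤ m, h p = f p) ∧ f (m + 1) = step m h := by
  let h : ℕ → ℕ → α := fun m =>
    Nat.rec (fun _ => a₀) (fun m hm => Function.update hm (m + 1) (step m hm)) m
  have hs : ∀ m, h (m + 1) = Function.update (h m) (m + 1) (step m (h m)) := fun _ => rfl
  have key : ∀ m p, p ≤ m → h m p = h p p := by
    intro m
    induction m with
    | zero => intro p hp; rw [Nat.le_zero.1 hp]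
    | succ m ih =>
      intro p hp
      rcases Nat.lt_or_eq_of_le hp with hlt | rfl
      · rw [hs, Function.update_of_ne (by omega), ih p (by omega)]
      · rfl
  exact ⟨fun m => h m m, rfl, fun m => ⟨h m, key m, by simp only [hs, Function.update_self]⟩⟩

section

variable {k : Type*} [CommRing k] {n : ℕ} [NeZero n]

/-- Cyclic difference equations are solvable up to a constant. -/
theorem exists_cyclic_difference (hn : IsUnit (n : k)) {τ : k} (hτ : IsUnit τ) (w : Fin n → k) :
    ∃ (v : Fin n → k) (e : k), ∀ i : Fin n,
      τ * v i - τ * v (i + Fin.ofNat n 1) + w (i + Fin.ofNat n 1) = e := by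
  obtain ⟨c, hc⟩ := hn.exists_right_inv
  obtain ⟨σ, hσ⟩ := hτ.exists_right_inv
  -- Summing the equations around the cycle forces `e` to be the mean of `w`; the partial sums of `w
  -- - e`, divided by `τ`, then solve them and close up at the wrap-around.
  set e : k := c * ∑ l, w l with he
  have hsum : ∑ l, (w l - e) = 0 := by
    rw [Finset.sum_sub_distrib, Finset.sum_const, Finset.card_univ, Fintype.card_fin, nsmul_eq_mul,
      he, ← mul_assoc, hc, one_mul, sub_self]
  refine ⟨fun i => σ * ∑ l with l ≤ i, (w l - e), e, fun i => ?_⟩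
  simp only [← mul_assoc, hσ, one_mul]
  rcases lt_or_eq_of_le (Nat.succ_le_of_lt i.2) with h | h
  · have hv : ((i + Fin.ofNat n 1 : Fin n) : ℕ) = i + 1 := by
      rw [Fin.val_add, Fin.val_ofNat, Nat.add_mod_mod, Nat.mod_eq_of_lt h]
    have : Finset.univ.filter (fun l : Fin n => l ≤ i + Fin.ofNat n 1) =
        (insert (i + Fin.ofNat n 1) (Finset.univ.filter fun l : Fin n => l ≤ i) :
          Finset (Fin n)) := by
      ext l
      simp only [Finset.mem_filter, Finset.mem_univ, true_and, Finset.mem_insert, Fin.le_def,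
        Fin.ext_iff, hv]
      omega
    rw [this, Finset.sum_insert]
    · ring
    · rw [Finset.mem_filter, Fin.le_def, hv]
      omega
  · have hv : ((i + Fin.ofNat n 1 : Fin n) : ℕ) = 0 := by
      rw [Fin.val_add, Fin.val_ofNat, Nat.add_mod_mod, show (i : ℕ) + 1 = n from h, Nat.mod_self]
    have h1 : Finset.univ.filter (fun l : Fin n => l ≤ i) = Finset.univ := by
      ext l
      have := l.2
      simp only [Finset.mem_filter, Finset.mem_univ, true_and, Fin.le_def, iff_true]
      omega
    have h2 : Finset.univ.filter (fun l : Fin n => l ≤ i + Fin.ofNat n 1) =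
        {i + Fin.ofNat n 1} := by
      ext l
      simp only [Finset.mem_filter, Finset.mem_univ, true_and, Fin.le_def, Finset.mem_singleton,
        Fin.ext_iff, hv]
      omega
    rw [h1, h2, hsum, Finset.sum_singleton]
    ring

/-- Since the leading term is `τ` times a cyclic permutation, the next coefficients of `l` and `e`
solve a cyclic difference equation whose inhomogeneity is already known. Working over any
commutative ring with `n` and `τ` invertible is what later yields holomorphic dependence on the
times. -/
theorem exists_eigenrow_powerSeries (hn : IsUnit (n : k)) {τ : k} (hτ : IsUnit τ)
    (b : Matrix (Fin n) (Fin n) (PowerSeries k))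
    (hb : ∀ i j, PowerSeries.coeff 0 (b i j) = if i + Fin.ofNat n 1 = j then τ else 0) :
    ∃ (l : Fin n → PowerSeries k) (e : PowerSeries k), (∀ j, ∑ i, l i * b i j = e * l j) ∧
      (∀ j, PowerSeries.coeff 0 (l j) = 1) ∧ PowerSeries.coeff 0 e = τ := by
  choose V E hVE using exists_cyclic_difference hn hτ
  -- The part of the coefficient of order `m + 1` of `l b - e l` that involves only coefficients of
  -- `l` and `e` of order at most `m`.
  let w : ℕ → (ℕ → (Fin n → k) × k) → Fin n → k := fun m a j =>
    ∑ i, ∑ p ∈ Finset.range (m + 1), (a p).1 i * PowerSeries.coeff (m + 1 - p) (b i j) -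
      ∑ p ∈ Finset.range m, (a (p + 1)).2 * (a (m - p)).1 j
  obtain ⟨f, hf0, hf⟩ := exists_seq_of_step ((fun _ => 1, τ) : (Fin n → k) × k)
    fun m a => (V (w m a), E (w m a))
  have hfs : ∀ m, f (m + 1) = (V (w m f), E (w m f)) := by
    intro m
    obtain ⟨h, hh, hfm⟩ := hf m
    have : w m h = w m f := by
      funext j
      simp only [w]
      congr 1
      · refine Finset.sum_congr rfl fun i _ => Finset.sum_congr rfl fun p hp => ?_
        rw [hh p (by rw [Finset.mem_range] at hp; omega)]
      · refine Finset.sum_congr rfl fun p hp => ?_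
        rw [Finset.mem_range] at hp
        rw [hh (p + 1) (by omega), hh (m - p) (by omega)]
    rw [hfm, this]
  have hB0 : ∀ (u : Fin n → k) (i : Fin n),
      ∑ i', u i' * PowerSeries.coeff 0 (b i' (i + Fin.ofNat n 1)) = τ * u i := by
    intro u i
    rw [Finset.sum_eq_single i]
    · rw [hb, if_pos rfl, mul_comm]
    · intro i' _ hi'
      rw [hb, if_neg (fun h => hi' (add_right_cancel h)), mul_zero]
    · simp
  have hsurj : ∀ j : Fin n, ∃ i, i + Fin.ofNat n 1 = j := fun j => ⟨j - Fin.ofNat n 1, by simp⟩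
  refine ⟨fun j => PowerSeries.mk fun m => (f m).1 j, PowerSeries.mk fun m => (f m).2, ?_, ?_, ?_⟩
  · intro j
    obtain ⟨i, rfl⟩ := hsurj j
    ext m
    simp only [map_sum, PowerSeries.coeff_mul, PowerSeries.coeff_mk,
      Finset.Nat.sum_antidiagonal_eq_sum_range_succ_mk]
    cases m with
    | zero => simp [hb, hf0]
    | succ m =>
      have h1 := hVE (w m f) i
      have h2 := hB0 (f (m + 1)).1 i
      have h3 : w m f (i + Fin.ofNat n 1) = ∑ i', ∑ p ∈ Finset.range (m + 1),
        (f p).1 i' * PowerSeries.coeff (m + 1 - p) (b i' (i + Fin.ofNat n 1)) -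
        ∑ p ∈ Finset.range m, (f (p + 1)).2 * (f (m - p)).1 (i + Fin.ofNat n 1) := rfl
      rw [show V (w m f) = (f (m + 1)).1 by rw [hfs], show E (w m f) = (f (m + 1)).2 by rw [hfs],
        h3] at h1
      simp only [Finset.sum_range_succ _ (m + 1), Finset.sum_add_distrib, Nat.sub_self, h2]
      rw [Finset.sum_range_succ' _ m]
      simp only [hf0, Nat.sub_zero, Nat.add_sub_add_right]
      linear_combination h1
  · intro j
    simp [hf0]
  · simp [hf0]

theorem eq_single_mul_ofPowerSeries {f : LaurentSeries k} {N : ℤ} (hf : VanishBelow N f) :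
    f = HahnSeries.single N 1 *
      HahnSeries.ofPowerSeries ℤ k (PowerSeries.mk fun p => f.coeff (N + p)) := by
  ext m
  rw [coeff_single_mul', one_mul, PowerSeries.coeff_coe]
  split_ifs with h
  · exact hf m (by omega)
  · rw [PowerSeries.coeff_mk]
    congr 1
    omega

theorem vanishBelow_ofPowerSeries (p : PowerSeries k) :
    VanishBelow 0 (HahnSeries.ofPowerSeries ℤ k p) := fun m hm => by
  rw [PowerSeries.coeff_coe, if_pos hm]

/-- A matrix `τ' q^(-N) + τ q^(-N-1) C + O(q^(-N-2))`, `C` the cyclic permutation matrix, has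
a row eigenvector `(1, …, 1) + O(q⁻¹)` with eigenvalue `τ' q^(-N) + τ q^(-N-1) + O(q^(-N-2))`. -/
theorem exists_eigenrow (hn : IsUnit (n : k)) {τ τ' : k} (hτ : IsUnit τ) {N : ℤ}
    (B : Matrix (Fin n) (Fin n) (LaurentSeries k)) (hB : ∀ i j, VanishBelow N (B i j))
    (hB0 : ∀ i j, (B i j).coeff N = if i = j then τ' else 0)
    (hB1 : ∀ i j, (B i j).coeff (N + 1) = if i + Fin.ofNat n 1 = j then τ else 0) :
    ∃ (l : Fin n → LaurentSeries k) (y : LaurentSeries k), (∀ j, ∑ i, l i * B i j = y * l j) ∧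
      (∀ j, VanishBelow 0 (l j)) ∧ (∀ j, (l j).coeff 0 = 1) ∧
      VanishBelow N y ∧ y.coeff N = τ' ∧ y.coeff (N + 1) = τ := by
  -- The scalar term `τ'` only shifts the eigenvalue, so it is removed before the cyclic part is
  -- normalized to order zero.
  set b : Matrix (Fin n) (Fin n) (PowerSeries k) :=
    Matrix.of fun i j => PowerSeries.mk fun p => (B i j).coeff (N + 1 + p) with hb
  have hBb : ∀ i j, B i j = HahnSeries.single N (if i = j then τ' else 0) +
      HahnSeries.single (N + 1) 1 * HahnSeries.ofPowerSeries ℤ k (b i j) := by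
    intro i j
    rw [← hB0, hb]
    ext m
    rw [HahnSeries.coeff_add, coeff_single_mul', one_mul, PowerSeries.coeff_coe,
      HahnSeries.coeff_single]
    rcases lt_trichotomy m N with h | rfl | h
    · rw [if_neg h.ne, if_pos (by omega), hB i j m h, add_zero]
    · simp
    · rw [if_neg h.ne', if_neg (by omega), zero_add, Matrix.of_apply, PowerSeries.coeff_mk]
      congr 1
      omega
  obtain ⟨l, e, hle, hl, he⟩ := exists_eigenrow_powerSeries hn hτ b fun i j => by
    rw [hb, Matrix.of_apply, PowerSeries.coeff_mk, Nat.cast_zero, add_zero, hB1]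
  refine ⟨fun j => HahnSeries.ofPowerSeries ℤ k (l j), HahnSeries.single N τ' +
    HahnSeries.single (N + 1) 1 * HahnSeries.ofPowerSeries ℤ k e, ?_,
    fun j => vanishBelow_ofPowerSeries _, ?_, ?_, ?_, ?_⟩
  · intro j
    have := congrArg (HahnSeries.ofPowerSeries ℤ k) (hle j)
    simp only [map_sum, map_mul] at this
    simp only [hBb, mul_add, add_mul, Finset.sum_add_distrib]
    rw [mul_assoc, ← this, Finset.mul_sum, Finset.sum_eq_single j]
    · rw [if_pos rfl, mul_comm]
      congr 1
      exact Finset.sum_congr rfl fun i _ => by ring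
    · intro i _ hi
      rw [if_neg hi, HahnSeries.single_eq_zero, mul_zero]
    · simp
  · intro j
    rw [PowerSeries.coeff_coe]
    simpa using hl j
  · refine (vanishBelow_single _ le_rfl).add ?_
    have := (vanishBelow_ofPowerSeries e).single_mul (N + 1) 1
    exact this.mono (by omega)
  · rw [HahnSeries.coeff_add, coeff_single_mul', PowerSeries.coeff_coe]
    simp
  · rw [HahnSeries.coeff_add, coeff_single_mul', PowerSeries.coeff_coe, HahnSeries.coeff_single]
    simpa using he

end

/-! ### Differentiation, polynomial parts and residues in `x` -/

section Scalar

theorem coeff_ddx (f : LaurentSeries ℂ) (m : ℤ) :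
    (ddx f).coeff m = -((m - 1 : ℤ) * f.coeff (m - 1)) := by
  rw [ddx, HahnSeries.coeff_neg, coeff_single_mul', one_mul, LaurentSeries.derivative_apply,
    LaurentSeries.hasseDeriv_coeff, Ring.choose_one_right, zsmul_eq_mul]
  push_cast
  rw [show m - 2 + 1 = m - 1 by ring]
  ring

theorem ddx_zero : ddx 0 = 0 := by
  rw [ddx, map_zero, mul_zero, neg_zero]

theorem ddx_sub (f g : LaurentSeries ℂ) : ddx (f - g) = ddx f - ddx g := by
  rw [ddx, map_sub, mul_sub, neg_sub', ddx, ddx]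

theorem ddx_sum {ι : Type*} (s : Finset ι) (f : ι → LaurentSeries ℂ) :
    ddx (∑ i ∈ s, f i) = ∑ i ∈ s, ddx (f i) := by
  simp only [ddx, map_sum, Finset.mul_sum, Finset.sum_neg_distrib]

theorem ddx_one : ddx 1 = 0 := by
  ext m
  rw [coeff_ddx, HahnSeries.coeff_one, HahnSeries.coeff_zero]
  split_ifs with h
  · simp [h]
  · simp

theorem VanishBelow.ddx {f : LaurentSeries ℂ} {N : ℤ} (hf : VanishBelow N f) :
    VanishBelow (N + 1) (ddx f) := fun m hm => by
  rw [coeff_ddx, hf _ (by omega), mul_zero, neg_zero]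

theorem ddx_mul (f g : LaurentSeries ℂ) : ddx (f * g) = ddx f * g + f * ddx g := by
  obtain ⟨a, hf⟩ := exists_vanishBelow f
  obtain ⟨b, hg⟩ := exists_vanishBelow g
  ext m
  have hf' : VanishBelow a (ddx f) := hf.ddx.mono (by omega)
  rw [HahnSeries.coeff_add, coeff_mul_eq_sum hf.ddx hg, coeff_mul_eq_sum hf hg.ddx, coeff_ddx,
    coeff_mul_eq_sum hf hg]
  have h1 : ∑ i ∈ Finset.Icc (a + 1) (m - b), (ddx f).coeff i * g.coeff (m - i) =
      ∑ i ∈ Finset.Icc a (m - 1 - b), (ddx f).coeff (i + 1) * g.coeff (m - (i + 1)) := by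
    refine Finset.sum_nbij' (fun i => i - 1) (fun i => i + 1) ?_ ?_ ?_ ?_ ?_
    · intro i hi
      rw [Finset.mem_Icc] at hi ⊢
      omega
    · intro i hi
      rw [Finset.mem_Icc] at hi ⊢
      omega
    · intro i _
      ring
    · intro i _
      ring
    · intro i _
      rw [sub_add_cancel]
  rw [h1, show m - (b + 1) = m - 1 - b by ring, ← Finset.sum_add_distrib, Finset.mul_sum,
    ← Finset.sum_neg_distrib]
  refine Finset.sum_congr rfl fun i _ => ?_
  rw [coeff_ddx, coeff_ddx, add_sub_cancel_right, show m - (i + 1) = m - 1 - i by ring,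
    show m - i - 1 = m - 1 - i by ring]
  push_cast
  ring

theorem coeff_one_ddx (f : LaurentSeries ℂ) : (ddx f).coeff 1 = 0 := by
  rw [coeff_ddx, sub_self, Int.cast_zero, zero_mul, neg_zero]

theorem aeval_X_monomial (m : ℕ) (c : ℂ) :
    Polynomial.aeval X (Polynomial.monomial m c) = HahnSeries.single (-(m : ℤ)) c := by
  rw [Polynomial.aeval_monomial, algebraMap_eq_C, X, HahnSeries.single_pow, HahnSeries.C_apply,
    HahnSeries.single_mul_single, one_pow, mul_one, zero_add]
  simp

theorem coeff_aeval_X (p : Polynomial ℂ) (m : ℕ) :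
    (Polynomial.aeval X p).coeff (-(m : ℤ)) = p.coeff m := by
  induction p using Polynomial.induction_on' with
  | add p q hp hq => rw [map_add, HahnSeries.coeff_add, hp, hq, Polynomial.coeff_add]
  | monomial k c =>
    rw [aeval_X_monomial, HahnSeries.coeff_single, Polynomial.coeff_monomial]
    simp [eq_comm]

theorem coeff_aeval_X_of_pos (p : Polynomial ℂ) {m : ℤ} (hm : 0 < m) :
    (Polynomial.aeval X p).coeff m = 0 := by
  induction p using Polynomial.induction_on' with
  | add p q hp hq => rw [map_add, HahnSeries.coeff_add, hp, hq, add_zero]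
  | monomial k c => rw [aeval_X_monomial, HahnSeries.coeff_single_of_ne (by omega)]

theorem ddx_aeval_X (p : Polynomial ℂ) :
    ddx (Polynomial.aeval X p) = Polynomial.aeval X (Polynomial.derivative p) := by
  ext m
  rw [coeff_ddx]
  rcases lt_or_ge 0 m with h | h
  · rw [coeff_aeval_X_of_pos _ h]
    rcases eq_or_ne m 1 with rfl | h1
    · simp
    · rw [coeff_aeval_X_of_pos _ (by omega), mul_zero, neg_zero]
  · obtain ⟨k, rfl⟩ : ∃ k : ℕ, m = -k := ⟨m.natAbs, by omega⟩
    rw [show -(k : ℤ) - 1 = -((k + 1 : ℕ) : ℤ) by push_cast; ring, coeff_aeval_X, coeff_aeval_X,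
      Polynomial.coeff_derivative]
    push_cast
    ring

theorem coeff_polyPart (f : LaurentSeries ℂ) (m : ℕ) :
    (polyPart f).coeff m = f.coeff (-(m : ℤ)) := by
  rw [polyPart, Polynomial.finsetSum_coeff]
  simp only [Polynomial.coeff_monomial, Finset.sum_ite_eq', Finset.mem_range]
  split_ifs with h
  · rfl
  · exact (HahnSeries.coeff_eq_zero_of_lt_order (by omega)).symm

/-- The polynomial part of a Laurent series, as a Laurent series. -/
def nonnegPart (f : LaurentSeries ℂ) : LaurentSeries ℂ := Polynomial.aeval X (polyPart f)

theorem vanishBelow_sub_nonnegPart (f : LaurentSeries ℂ) : VanishBelow 1 (f - nonnegPart f) := by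
  intro m hm
  obtain ⟨k, rfl⟩ : ∃ k : ℕ, m = -k := ⟨m.natAbs, by omega⟩
  rw [HahnSeries.coeff_sub, nonnegPart, coeff_aeval_X, coeff_polyPart, sub_self]

theorem eq_nonnegPart {f : LaurentSeries ℂ} (hf : ∀ m > 0, f.coeff m = 0) : f = nonnegPart f := by
  ext m
  rcases lt_or_ge 0 m with h | h
  · rw [hf m h, nonnegPart, coeff_aeval_X_of_pos _ h]
  · obtain ⟨k, rfl⟩ : ∃ k : ℕ, m = -k := ⟨m.natAbs, by omega⟩
    rw [nonnegPart, coeff_aeval_X, coeff_polyPart]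

/-- Only the constant terms of the polynomial parts can differ, and `d/dx` kills them. -/
theorem ddx_nonnegPart_eq_of_vanishBelow {f g : LaurentSeries ℂ} (h : VanishBelow 0 (f - g)) :
    ddx (nonnegPart f) = ddx (nonnegPart g) := by
  ext m
  rw [coeff_ddx, coeff_ddx]
  rcases lt_trichotomy (m - 1) 0 with hm | hm | hm
  · obtain ⟨k, hk⟩ : ∃ k : ℕ, m - 1 = -k := ⟨(m - 1).natAbs, by omega⟩
    have := h _ hm
    rw [HahnSeries.coeff_sub, sub_eq_zero] at this
    rw [nonnegPart, nonnegPart, hk, coeff_aeval_X, coeff_aeval_X, coeff_polyPart, coeff_polyPart,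
      ← hk, this]
  · simp [hm]
  · rw [nonnegPart, nonnegPart, coeff_aeval_X_of_pos _ hm, coeff_aeval_X_of_pos _ hm]

theorem coeff_one_mul_ddx_nonnegPart (f g : LaurentSeries ℂ) :
    (nonnegPart f * ddx (nonnegPart g)).coeff 1 = 0 := by
  rw [nonnegPart, nonnegPart, ddx_aeval_X, ← map_mul, coeff_aeval_X_of_pos _ one_pos]

/-- Split both series into polynomial and negative parts. The residues of `f₋ dg₋` and of `g₊ df₊`
vanish for degree reasons, that of `d(f₊ g₋)` because it is exact. -/
theorem residue_skew (f g : LaurentSeries ℂ) :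
    (f * ddx (nonnegPart g)).coeff 1 - (g * ddx (nonnegPart f)).coeff 1 =
      (f * ddx g).coeff 1 := by
  set f' := f - nonnegPart f with hf'
  set g' := g - nonnegPart g with hg'
  have h1 : (f' * ddx g').coeff 1 = 0 :=
    ((vanishBelow_sub_nonnegPart f).mul (vanishBelow_sub_nonnegPart g).ddx) 1 (by norm_num)
  have h2 : (ddx (nonnegPart f * g')).coeff 1 = 0 := coeff_one_ddx _
  have h3 := coeff_one_mul_ddx_nonnegPart g f
  have e : f * ddx g = f * ddx (nonnegPart g) - g * ddx (nonnegPart f) + (f' * ddx g' +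
      (ddx (nonnegPart f * g') + nonnegPart g * ddx (nonnegPart f))) := by
    rw [ddx_mul, hf', hg', ddx_sub]
    ring
  rw [e, HahnSeries.coeff_add, HahnSeries.coeff_add, HahnSeries.coeff_add, h1, h2, h3,
    HahnSeries.coeff_sub]
  ring

end Scalar

/-! ### Residues of traces and invariance under conjugation. -/

section Matrices

variable {n : ℕ}

local notation "Mat" => Matrix (Fin n) (Fin n) (LaurentSeries ℂ)

theorem map_ddx_mul (M M' : Mat) :
    (M * M').map ddx = M.map ddx * M' + M * M'.map ddx := by
  ext1 i j
  simp only [Matrix.map_apply, Matrix.mul_apply, Matrix.add_apply, ddx_sum, ddx_mul,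
    Finset.sum_add_distrib]

theorem map_ddx_one : (1 : Mat).map ddx = 0 := by
  ext1 i j
  rcases eq_or_ne i j with rfl | h
  · simp [ddx_one]
  · simp [h, ddx_zero]

theorem residue_trace_skew (M M' : Mat) :
    (M * (M'.map nonnegPart).map ddx).trace.coeff 1 -
      (M' * (M.map nonnegPart).map ddx).trace.coeff 1 = (M * M'.map ddx).trace.coeff 1 := by
  simp only [Matrix.trace, Matrix.diag, Matrix.mul_apply, HahnSeries.coeff_sum, Matrix.map_apply]
  rw [Finset.sum_comm (f := fun i j => (M' i j * ddx (nonnegPart (M j i))).coeff 1),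
    ← Finset.sum_sub_distrib]
  refine Finset.sum_congr rfl fun i _ => ?_
  rw [← Finset.sum_sub_distrib]
  exact Finset.sum_congr rfl fun j _ => residue_skew _ _

/-- The trace of `M dM'` for commuting `M, M'` is invariant under simultaneous conjugation. -/
theorem trace_conj_mul_ddx {Z V P Q : Mat} (hVZ : V * Z = 1) (hPQ : P * Q = Q * P) :
    ((V * P * Z) * (V * Q * Z).map ddx).trace = (P * Q.map ddx).trace := by
  have hZV : Z * V = 1 := mul_eq_one_comm.1 hVZ
  have hd : Z.map ddx * V + Z * V.map ddx = 0 := by rw [← map_ddx_mul, hZV, map_ddx_one]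
  have hd' : Z * V.map ddx = -(Z.map ddx * V) := by
    rw [eq_neg_iff_add_eq_zero, add_comm]
    exact hd
  rw [map_ddx_mul, map_ddx_mul, add_mul, mul_add, mul_add, Matrix.trace_add, Matrix.trace_add]
  -- The two terms in which the derivative falls on the conjugating factors are opposite: `(Z V)' =
  -- 0` relates them and `P Q = Q P` matches the order.
  have e1 : ((V * P * Z) * (V.map ddx * Q * Z)).trace = -((P * Q * (Z.map ddx * V)).trace) := by
    rw [show (V * P * Z) * (V.map ddx * Q * Z) = V * (P * (Z * V.map ddx) * Q * Z) by
      simp only [mul_assoc], Matrix.trace_mul_comm, mul_assoc, hZV, mul_one, hd',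
      Matrix.trace_mul_comm, ← mul_assoc, ← hPQ, Matrix.mul_neg, Matrix.trace_neg]
  have e2 : ((V * P * Z) * (V * Q.map ddx * Z)).trace = (P * Q.map ddx).trace := by
    rw [show (V * P * Z) * (V * Q.map ddx * Z) = V * (P * (Z * V) * Q.map ddx * Z) by
      simp only [mul_assoc], Matrix.trace_mul_comm, mul_assoc, hZV, mul_one, mul_one]
  have e3 : ((V * P * Z) * (V * Q * Z.map ddx)).trace = (P * Q * (Z.map ddx * V)).trace := by
    rw [show (V * P * Z) * (V * Q * Z.map ddx) = V * (P * (Z * V) * Q * Z.map ddx) by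
      simp only [mul_assoc], Matrix.trace_mul_comm, hZV, mul_one, mul_assoc]
  rw [e1, e2, e3]
  ring

theorem residue_trace_bareH [NeZero n] {J K : ℕ} (hJ : 1 ≤ J) (hK : 1 ≤ K) :
    (bareH n ^ K * (bareH n ^ J).map ddx).trace.coeff 1 = 0 := by
  have key : ∀ J : ℕ, 1 ≤ J → ∀ i j, (bareH n ^ J) i j = nonnegPart ((bareH n ^ J) i j) := by
    intro J hJ i j
    refine eq_nonnegPart fun m hm => ?_
    rw [bareH_pow_eq_mulMat, coeff_mulMat, qPow, HahnSeries.coeff_single_of_ne]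
    have := i.2
    nlinarith
  simp only [Matrix.trace, Matrix.diag, Matrix.mul_apply, HahnSeries.coeff_sum, Matrix.map_apply]
  refine Finset.sum_eq_zero fun i _ => Finset.sum_eq_zero fun j _ => ?_
  rw [key J hJ, key K hK, coeff_one_mul_ddx_nonnegPart]

end Matrices

/-! ### Comparison of spectral and formal diagonalization -/

theorem eq_of_cyclic_invariant {n : ℕ} [NeZero n] {α : Type*} {f : Fin n → α}
    (h : ∀ i, f (i + Fin.ofNat n 1) = f i) (i : Fin n) : f i = f 0 := by
  have key : ∀ k : ℕ, f (Fin.ofNat n k) = f 0 := by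
    intro k
    induction k with
    | zero => congr 1
    | succ k ih =>
      rw [← ih, ← h (Fin.ofNat n k)]
      congr 1
      ext
      simp [Fin.val_add]
  rw [← key i]
  congr 1
  ext
  simp

theorem ofNat_add_ofNat {n : ℕ} [NeZero n] (a b : ℕ) :
    Fin.ofNat n a + Fin.ofNat n b = Fin.ofNat n (a + b) := by
  ext
  simp [Fin.val_add]

/-- A row vector `ω` which is an eigenvector of `δ(𝓗)` up to terms of high order is constant to high
order, and its eigenvalue agrees with `δ`. -/
theorem eigenrow_rigidity {n M : ℕ} [NeZero n] (c : ℕ → ℂ) (hM : Fin.ofNat n (M + 2) = 0)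
    (hc : c (M + 1) ≠ 0) {ω : Fin n → LaurentSeries ℂ} {y δ : LaurentSeries ℂ}
    (hδ : δ = ∑ J ∈ Finset.range (M + 3), HahnSeries.single ((n : ℤ) - J) (c J))
    (hω : ∀ j, VanishBelow 0 (ω j)) (hω0 : ∀ j, (ω j).coeff 0 = 1)
    (hy : VanishBelow (n - (M + 2 : ℕ)) y) (hy0 : y.coeff (n - (M + 2 : ℕ)) = c (M + 2))
    (hy1 : y.coeff (n - (M + 2 : ℕ) + 1) = c (M + 1))
    (h : ∀ j, VanishBelow n (y * ω j - ∑ J ∈ Finset.range (M + 3),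
      HahnSeries.single ((n : ℤ) - J) (c J) * ω (j + Fin.ofNat n J))) :
    (∀ j, VanishBelow (M + 1 : ℕ) (ω j - ω 0)) ∧ VanishBelow n (y - δ) := by
  have hdelta : ∀ a : ℤ, δ.coeff a =
      ∑ J ∈ Finset.range (M + 3), if a = n - J then c J else 0 := fun a => by
    simp only [hδ, HahnSeries.coeff_sum, HahnSeries.coeff_single]
    exact Finset.sum_congr rfl fun _ _ => by congr
  -- Each induction step uses the equation at index `a`, which lies in the range `a < n` covered by
  -- `h` exactly while `m ≤ M`.
  suffices H : ∀ m : ℕ, m ≤ M + 1 → (∀ j, VanishBelow m (ω j - ω 0)) ∧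
      VanishBelow (n - (M + 2 : ℕ) + 1 + m) (y - δ) by
    refine ⟨(H _ le_rfl).1, (H _ le_rfl).2.mono ?_⟩
    push_cast
    linarith
  intro m
  induction m with
  | zero =>
    refine fun _ => ⟨fun j => by simpa using (hω j).sub (hω 0), ?_⟩
    intro a ha
    rw [HahnSeries.coeff_sub, hdelta]
    rcases lt_or_eq_of_le (show a ≤ n - (M + 2 : ℕ) by omega) with hlt | rfl
    · rw [hy a hlt, Finset.sum_eq_zero, sub_zero]
      intro J hJ
      rw [Finset.mem_range] at hJ
      rw [if_neg (by omega)]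
    · rw [hy0, Finset.sum_eq_single (M + 2), if_pos rfl, sub_self]
      · intro J _ hJ
        rw [if_neg (by omega)]
      · simp
  | succ m ih =>
    intro hm
    obtain ⟨ih1, ih2⟩ := ih (by omega)
    set a : ℤ := n - (M + 2 : ℕ) + 1 + m with ha
    have expand : ∀ j, y * ω j - ∑ J ∈ Finset.range (M + 3),
        HahnSeries.single ((n : ℤ) - J) (c J) * ω (j + Fin.ofNat n J) =
        (y - δ) * ω 0 + y * (ω j - ω 0) - ∑ J ∈ Finset.range (M + 3),
          HahnSeries.single ((n : ℤ) - J) (c J) * (ω (j + Fin.ofNat n J) - ω 0) := by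
      intro j
      simp only [mul_sub, Finset.sum_sub_distrib, ← Finset.sum_mul, ← hδ]
      ring
    -- At index `a` only the two top terms `J = M + 2, M + 1` reach `ω - ω 0`. For `J = M + 2` the
    -- shift is trivial, so its contribution cancels against the leading term of `y`.
    have eq0 : ∀ j, (y - δ).coeff a +
        c (M + 1) * ((ω j - ω 0).coeff m - (ω (j + Fin.ofNat n (M + 1)) - ω 0).coeff m) = 0 := by
      intro j
      have h1 := h j a (by omega)
      rw [expand] at h1
      have h2 : ((y - δ) * ω 0).coeff a = (y - δ).coeff a := by
        have := coeff_mul_lowest ih2 (hω 0)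
        rw [add_zero, hω0, mul_one] at this
        exact this
      have h3 : (y * (ω j - ω 0)).coeff a =
          c (M + 2) * (ω j - ω 0).coeff (m + 1) + c (M + 1) * (ω j - ω 0).coeff m := by
        rw [← hy0, ← hy1, ← coeff_mul_second hy (ih1 j)]
        congr 1
        omega
      have h4 : (∑ J ∈ Finset.range (M + 3), HahnSeries.single ((n : ℤ) - J) (c J) *
          (ω (j + Fin.ofNat n J) - ω 0)).coeff a = c (M + 2) * (ω j - ω 0).coeff (m + 1) +
            c (M + 1) * (ω (j + Fin.ofNat n (M + 1)) - ω 0).coeff m := by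
        rw [Finset.sum_range_succ, Finset.sum_range_succ, HahnSeries.coeff_add,
          HahnSeries.coeff_add, HahnSeries.coeff_sum, Finset.sum_eq_zero, zero_add,
          coeff_single_mul', coeff_single_mul', hM, add_zero, add_comm]
        · congr 3 <;> push_cast [ha] <;> ring
        · intro J hJ
          rw [Finset.mem_range] at hJ
          rw [coeff_single_mul', ih1 _ _ (by omega), mul_zero]
      rw [HahnSeries.coeff_sub, HahnSeries.coeff_add, h2, h3, h4] at h1
      linear_combination h1
    -- Summing `eq0` over the cycle cancels the differences.
    have he : (y - δ).coeff a = 0 := by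
      have hsum := Finset.sum_eq_zero fun j (_ : j ∈ Finset.univ) => eq0 j
      have hshift : ∑ j, (ω (j + Fin.ofNat n (M + 1)) - ω 0).coeff m =
          ∑ j, (ω j - ω 0).coeff m :=
        Equiv.sum_comp (Equiv.addRight (Fin.ofNat n (M + 1))) fun j => (ω j - ω 0).coeff (m : ℤ)
      rw [Finset.sum_add_distrib, ← Finset.mul_sum, Finset.sum_sub_distrib, hshift, sub_self,
        mul_zero, add_zero, Finset.sum_const, Finset.card_univ, Fintype.card_fin, nsmul_eq_mul,
        mul_eq_zero] at hsum
      exact hsum.resolve_left (by exact_mod_cast NeZero.ne n)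
    -- Modulo `n`, a shift by `M + 1` is a shift by `-1`; it therefore generates all shifts, and the
    -- coefficient is the same for all components.
    have hinv : ∀ i, (ω (i + Fin.ofNat n 1) - ω 0).coeff (m : ℤ) = (ω i - ω 0).coeff (m : ℤ) := by
      intro i
      have := eq0 (i + Fin.ofNat n 1)
      rw [he, zero_add, add_assoc, ofNat_add_ofNat, show 1 + (M + 1) = M + 2 by ring, hM, add_zero,
        mul_eq_zero, sub_eq_zero] at this
      exact this.resolve_left hc
    refine ⟨fun j p hp => ?_, fun p hp => ?_⟩
    · rcases lt_or_eq_of_le (show p ≤ m by push_cast at hp; omega) with hlt | rfl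
      · exact ih1 j p hlt
      · rw [eq_of_cyclic_invariant (f := fun i => (ω i - ω 0).coeff (m : ℤ)) hinv j, sub_self,
          HahnSeries.coeff_zero]
    · rcases lt_or_eq_of_le (show p ≤ a by push_cast at hp; omega) with hlt | rfl
      · exact ih2 p hlt
      · exact he

/-! ### Matrices congruent to the identity -/

section Unipotent

variable {n : ℕ} [NeZero n]

local notation "Mat" => Matrix (Fin n) (Fin n) (LaurentSeries ℂ)

-- The determinant has constant coefficient 1, hence is a unit in power series in `1/q`, and the
-- inverse has entries there too.
omit [NeZero n] in
theorem exists_integral_inverse {M : Mat} (hM : ∀ i j, VanishBelow 0 (M i j))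
    (hM0 : ∀ i j, (M i j).coeff 0 = (1 : Matrix (Fin n) (Fin n) ℂ) i j) :
    ∃ V : Mat, V * M = 1 ∧ ∀ i j, VanishBelow 0 (V i j) := by
  set P : Matrix (Fin n) (Fin n) (PowerSeries ℂ) :=
    Matrix.of fun i j => PowerSeries.mk fun p => (M i j).coeff p with hP
  have hMP : M = P.map (HahnSeries.ofPowerSeries ℤ ℂ) := by
    ext1 i j
    have := eq_single_mul_ofPowerSeries (hM i j)
    simpa [hP] using this
  have hdet : IsUnit P.det := by
    rw [PowerSeries.isUnit_iff_constantCoeff, RingHom.map_det,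
      show (PowerSeries.constantCoeff (R := ℂ)).mapMatrix P = 1 from ?_, Matrix.det_one]
    · exact isUnit_one
    · ext1 i j
      rw [← hM0, hP, RingHom.mapMatrix_apply, Matrix.map_apply, Matrix.of_apply,
        ← PowerSeries.coeff_zero_eq_constantCoeff_apply, PowerSeries.coeff_mk, Nat.cast_zero]
  refine ⟨P⁻¹.map (HahnSeries.ofPowerSeries ℤ ℂ), ?_, fun i j => vanishBelow_ofPowerSeries _⟩
  rw [hMP, ← Matrix.map_mul, Matrix.nonsing_inv_mul _ hdet]
  exact Matrix.map_one _ (map_zero _) (map_one _)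

theorem coeff_zero_shear (M : Mat) (i j : Fin n) :
    (shear M i j).coeff 0 = if i = j then (M i j).coeff 0 else 0 := by
  rcases eq_or_ne i j with rfl | h
  · have := coeff_shear M i i 0
    simpa using this
  · have := coeff_shear_of_ne M h j 0
    simpa [h] using this

theorem det_shear_eq_zero {M : Mat} (h : M.det = 0) : (shear M).det = 0 := by
  have : shear M = Matrix.diagonal (fun i : Fin n => HahnSeries.single (-(i : ℤ)) (1 : ℂ)) *
      M.map (expandHom n) * Matrix.diagonal fun j : Fin n => HahnSeries.single (j : ℤ) (1 : ℂ) := by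
    ext1 i j
    rw [Matrix.mul_diagonal, Matrix.diagonal_mul, mul_right_comm, HahnSeries.single_mul_single,
      mul_one, neg_add_eq_sub]
    rfl
  rw [this, Matrix.det_mul, Matrix.det_mul, ← RingHom.mapMatrix_apply, ← RingHom.map_det, h,
    map_zero, mul_zero, zero_mul]

/-- The sheared matrix is congruent to the identity modulo `1/q`. -/
structure IsUnipotent (M : Mat) : Prop where
  integral : ∀ i j, VanishBelow 0 (shear M i j)
  coeff_zero : ∀ i j, (shear M i j).coeff 0 = (1 : Matrix (Fin n) (Fin n) ℂ) i j

omit [NeZero n] in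
theorem vanishBelow_matrix_mul {M M' : Mat} {a b : ℤ} (h : ∀ i j, VanishBelow a (M i j))
    (h' : ∀ i j, VanishBelow b (M' i j)) (i j : Fin n) : VanishBelow (a + b) ((M * M') i j) := by
  rw [Matrix.mul_apply]
  exact VanishBelow.sum fun l _ => (h i l).mul (h' l j)

theorem IsUnipotent.mul {M M' : Mat} (h : IsUnipotent M) (h' : IsUnipotent M') :
    IsUnipotent (M * M') where
  integral i j := by
    rw [shear_mul]
    simpa using vanishBelow_matrix_mul h.integral h'.integral i j
  coeff_zero i j := by
    rw [shear_mul, Matrix.mul_apply, HahnSeries.coeff_sum, ← mul_one (1 : Matrix _ _ ℂ),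
      Matrix.mul_apply]
    refine Finset.sum_congr rfl fun l _ => ?_
    rw [← h.coeff_zero, ← h'.coeff_zero, ← coeff_mul_lowest (h.integral i l) (h'.integral l j),
      add_zero]

theorem IsUnipotent.isUnit_det {M : Mat} (h : IsUnipotent M) : IsUnit M.det := by
  rw [isUnit_iff_ne_zero]
  intro h0
  obtain ⟨V, hV, -⟩ := exists_integral_inverse h.integral h.coeff_zero
  have := congrArg Matrix.det hV
  rw [Matrix.det_mul, det_shear_eq_zero h0, mul_zero, Matrix.det_one] at this
  exact zero_ne_one this

theorem IsUnipotent.integral_inv {M : Mat} (h : IsUnipotent M) (i j : Fin n) :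
    VanishBelow 0 (shear M⁻¹ i j) := by
  obtain ⟨V, hV, hV'⟩ := exists_integral_inverse h.integral h.coeff_zero
  have h1 : shear M * shear M⁻¹ = 1 := by
    rw [← shear_mul, Matrix.mul_nonsing_inv _ h.isUnit_det, shear_one]
  have : shear M⁻¹ = V := by
    rw [← one_mul (shear M⁻¹), ← hV, mul_assoc, h1, mul_one]
  rw [this]
  exact hV' i j

theorem IsUnipotent.unshear {u : Fin n → LaurentSeries ℂ} (hu : ∀ j, VanishBelow 0 (u j))
    (hu0 : ∀ j, (u j).coeff 0 = 1) : IsUnipotent (unshear u) where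
  integral := vanishBelow_shear fun j => by rw [colSum_unshear]; exact hu j
  coeff_zero i j := by
    rw [coeff_zero_shear, Matrix.one_apply]
    split_ifs with h
    · subst h
      rw [coeff_unshear]
      simpa using hu0 i
    · rfl

/-- The entry `(i, j)` at `x^(-k)` moves to index `n k + j - i`. For `k = 0` this is negative below
the diagonal, where `Y_0` vanishes, and positive above it, so the unknown strictly upper triangular
part disappears modulo `1/q`. -/
theorem IsUnipotent.of_isNormalized {Y : Mat} (hY : ∀ a b m, m < 0 → (Y a b).coeff m = 0)
    (hN : IsNormalized Y) : IsUnipotent Y where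
  integral i j m hm := by
    obtain ⟨i', k, rfl⟩ := exists_index j m
    rcases eq_or_ne i i' with rfl | h
    · rw [coeff_shear]
      have h1 := i.2
      rcases lt_trichotomy k 0 with hk | rfl | hk
      · exact hY _ _ _ hk
      · have hji : j < i := by
          rw [Fin.lt_def]
          omega
        have := hN i j hji.le
        rw [constCoeff, Matrix.map_apply, Matrix.one_apply_ne hji.ne'] at this
        exact this
      · nlinarith
    · exact coeff_shear_of_ne Y h j k
  coeff_zero i j := by
    rw [coeff_zero_shear]
    split_ifs with h
    · subst h
      exact hN i i le_rfl
    · rw [Matrix.one_apply_ne h]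

/-- Shearing moves exponents by less than `n`, that is, by less than one power of `x`. -/
theorem vanishBelow_of_shear {M : Mat} {i j : Fin n} (h : VanishBelow 0 (shear M i j)) :
    VanishBelow 0 (M i j) := fun k hk => by
  rw [← coeff_shear]
  refine h _ ?_
  have := j.2
  nlinarith

end Unipotent

/-! ### The normalized formal gauge -/

/-- A matrix commuting with an upper triangular Toeplitz matrix with nonvanishing superdiagonal is
upper triangular with constant diagonal. -/
theorem triangular_of_commute_toeplitz {n : ℕ} [NeZero n] {τ : ℕ → ℂ} (hτ : τ 1 ≠ 0)
    {T Y : Matrix (Fin n) (Fin n) ℂ}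
    (hT : ∀ i j : Fin n, T i j = if i ≤ j then τ ((j : ℕ) - i) else 0) (h : T * Y = Y * T) :
    (∀ i j, j < i → Y i j = 0) ∧ ∀ i, Y i i = Y 0 0 := by
  have ent : ∀ i j, ∑ l, T i l * Y l j = ∑ l, Y i l * T l j := fun i j => by
    rw [← Matrix.mul_apply, h, Matrix.mul_apply]
  -- `T` is upper triangular, so below-vanishing of column `j` leaves only the diagonal and
  -- superdiagonal terms of row `p` of `T Y`.
  have step : ∀ p q : Fin n, (q : ℕ) = p + 1 → ∀ j : Fin n, (∀ l, q < l → Y l j = 0) →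
      ∑ l, T p l * Y l j = τ 0 * Y p j + τ 1 * Y q j := by
    intro p q hpq j hl
    rw [Fintype.sum_eq_add p q (by intro e; rw [e] at hpq; omega)]
    · rw [hT, hT, if_pos le_rfl, if_pos (by rw [Fin.le_def]; omega), Nat.sub_self,
        show (q : ℕ) - p = 1 by omega]
    · rintro l ⟨hlp, hlq⟩
      rcases lt_or_gt_of_ne hlq with h1 | h1
      · rw [hT, if_neg, zero_mul]
        rw [Fin.le_def]
        rw [Fin.lt_def] at h1
        rw [Ne, Fin.ext_iff] at hlp
        omega
      · rw [hl l h1, mul_zero]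
  -- Columns are cleared from left to right and, within a column, entries from the bottom up:
  -- comparing `T Y` with `Y T` just above the entry leaves `τ 1 * Y i j = 0`.
  have lower : ∀ (k : ℕ) (j : Fin n), (j : ℕ) = k → ∀ i, j < i → Y i j = 0 := by
    intro k
    induction k using Nat.strong_induction_on with
    | _ k ihk =>
      intro j hj
      have down : ∀ (d : ℕ) (i : Fin n), n - (i : ℕ) = d → j < i → Y i j = 0 := by
        intro d
        induction d using Nat.strong_induction_on with
        | _ d ihd =>
          intro i hi hji
          rw [Fin.lt_def] at hji
          have hi' := i.2
          let p : Fin n := ⟨i - 1, by omega⟩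
          have hp : (p : ℕ) = i - 1 := rfl
          have h1 := step p i (by omega) j fun l hl => by
            have := l.2
            rw [Fin.lt_def] at hl
            exact ihd (n - l) (by omega) l rfl (by rw [Fin.lt_def]; omega)
          have h2 : ∑ l, Y p l * T l j = τ 0 * Y p j := by
            rw [Fintype.sum_eq_single j]
            · rw [hT, if_pos le_rfl, Nat.sub_self, mul_comm]
            · intro l hl
              rcases lt_or_gt_of_ne hl with h3 | h3
              · rw [ihk l (by rw [Fin.lt_def] at h3; omega) l rfl p
                  (by rw [Fin.lt_def] at h3 ⊢; omega), zero_mul]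
              · rw [hT, if_neg (not_le.2 h3), mul_zero]
          rw [ent, h2] at h1
          have h3 : τ 1 * Y i j = 0 := by linear_combination -h1
          exact (mul_eq_zero.1 h3).resolve_left hτ
      exact fun i hi => down _ i rfl hi
  refine ⟨fun i j hij => lower _ j rfl i hij, ?_⟩
  have diag : ∀ (k : ℕ) (i : Fin n), (i : ℕ) = k → Y i i = Y 0 0 := by
    intro k
    induction k with
    | zero =>
      intro i hi
      rw [show i = 0 by ext; simpa using hi]
    | succ k ih =>
      intro i hi
      have hi' := i.2
      let p : Fin n := ⟨k, by omega⟩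
      have hp : (p : ℕ) = k := rfl
      have h1 := step p i (by omega) i fun l hl => lower _ i rfl l hl
      have h2 : ∑ l, Y p l * T l i = Y p p * τ 1 + Y p i * τ 0 := by
        rw [Fintype.sum_eq_add p i (by intro e; rw [← e, hp] at hi; omega)]
        · rw [hT, hT, if_pos le_rfl, if_pos (by rw [Fin.le_def]; omega), Nat.sub_self,
            show (i : ℕ) - p = 1 by omega]
        · rintro l ⟨hlp, hli⟩
          rcases lt_or_gt_of_ne hlp with h3 | h3
          · rw [lower _ l rfl p h3, zero_mul]
          · rw [hT, if_neg, mul_zero]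
            rw [Fin.le_def]
            rw [Fin.lt_def] at h3
            rw [Ne, Fin.ext_iff] at hli
            omega
      rw [ent, h2] at h1
      have h3 : τ 1 * (Y p p - Y i i) = 0 := by linear_combination h1
      rw [← ih p hp]
      exact (sub_eq_zero.1 ((mul_eq_zero.1 h3).resolve_left hτ)).symm
  exact fun i => diag _ i rfl

section Gauge

variable {n : ℕ} [NeZero n] {N : ℕ}

local notation "Mat" => Matrix (Fin n) (Fin n) (LaurentSeries ℂ)

/-- The coefficients of `D` as a series in `𝓗`, up to the diagonal term `G`. -/
def bareCoeff (n : ℕ) {N : ℕ} (t₀ : ℂ) (t : Fin N → ℂ) (J : ℕ) : ℂ :=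
  (if J = 0 then t₀ else time t J) / n

omit [NeZero n] in
theorem mul_laurent_smul (c : LaurentSeries ℂ) (M M' : Mat) : M * (c • M') = c • (M * M') := by
  ext1 i j
  simp only [Matrix.mul_apply, Matrix.smul_apply, smul_eq_mul, Finset.mul_sum, mul_left_comm]

omit [NeZero n] in
theorem laurent_smul_mul (c : LaurentSeries ℂ) (M M' : Mat) : (c • M) * M' = c • (M * M') := by
  ext1 i j
  simp only [Matrix.mul_apply, Matrix.smul_apply, smul_eq_mul, Finset.mul_sum, mul_assoc]

omit [NeZero n] in
theorem smul_eq_C_smul (c : ℂ) (M : Mat) : c • M = (HahnSeries.C c : LaurentSeries ℂ) • M := by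
  ext i j m
  simp

theorem colSum_smul (c : LaurentSeries ℂ) (M : Mat) (j : Fin n) :
    colSum (c • M) j = expandHom n c * colSum M j := by
  simp only [colSum, shear, Matrix.of_apply, Matrix.smul_apply, smul_eq_mul, map_mul,
    Finset.mul_sum]
  exact Finset.sum_congr rfl fun i _ => by ring

theorem colSum_C_smul (c : ℂ) (M : Mat) (j : Fin n) :
    colSum (c • M) j = HahnSeries.single 0 c * colSum M j := by
  rw [smul_eq_C_smul, colSum_smul, expandHom_C]
  rfl

theorem inv_natCast_mul_X : ((n : LaurentSeries ℂ) * X)⁻¹ = HahnSeries.single 1 (1 / (n : ℂ)) := by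
  have hn : (n : ℂ) ≠ 0 := by exact_mod_cast NeZero.ne n
  refine inv_eq_of_mul_eq_one_right ?_
  rw [← HahnSeries.single_zero_natCast, X, HahnSeries.single_mul_single,
    HahnSeries.single_mul_single, mul_one, mul_one_div_cancel hn]
  rfl

theorem colSum_sum {ι : Type*} (s : Finset ι) (f : ι → Mat) (j : Fin n) :
    colSum (∑ i ∈ s, f i) j = ∑ i ∈ s, colSum (f i) j := by
  simp only [colSum, shear, Matrix.of_apply, Matrix.sum_apply, map_sum, Finset.mul_sum]
  exact Finset.sum_comm

theorem colSum_mul_bareG (W : Mat) (j : Fin n) :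
    colSum (W * bareG n) j = HahnSeries.single 0 ((j : ℕ) : ℂ) * colSum W j := by
  simp only [colSum, shear, Matrix.of_apply, bareG, Matrix.mul_diagonal, Finset.mul_sum, map_mul,
    map_natCast, HahnSeries.single_zero_natCast]
  exact Finset.sum_congr rfl fun i _ => by ring

/-- In the row model `D` acts by the shifts with weights `c_J q^(J-n)`, and `G` contributes only at
relative order `q^(-n)`. -/
theorem colSum_mul_bareD (W : Mat) (t₀ : ℂ) (t : Fin N → ℂ) (j : Fin n) :
    colSum (W * bareD n t₀ t) j = ∑ J ∈ Finset.range (N + 1),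
      HahnSeries.single ((n : ℤ) - J) (bareCoeff n t₀ t J) * colSum W (j + Fin.ofNat n J) -
        HahnSeries.single (n : ℤ) ((j : ℕ) / (n : ℂ)) * colSum W j := by
  have e : W * bareD n t₀ t = ((n : LaurentSeries ℂ) * X)⁻¹ •
      (t₀ • W + ∑ J ∈ Finset.Icc 1 N, time t J • (W * bareH n ^ J) - W * bareG n) := by
    have hs : ∀ (c : ℂ) (M : Mat), W * (c • M) = c • (W * M) := by
      intro c M
      rw [smul_eq_C_smul, smul_eq_C_smul, mul_laurent_smul]
    rw [bareD, mul_laurent_smul, mul_sub, mul_add, hs, mul_one, Finset.mul_sum]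
    simp only [hs]
  rw [e, colSum_smul, inv_natCast_mul_X, expandHom_single, mul_one, colSum_sub, colSum_add,
    Pi.sub_apply, Pi.add_apply, colSum_sum, colSum_C_smul, colSum_mul_bareG, mul_sub, mul_add,
    Finset.sum_range_succ', Finset.mul_sum]
  congr 1
  · rw [add_comm]
    congr 1
    · rw [Finset.range_eq_Ico, Finset.sum_Ico_add' (fun J : ℕ =>
        HahnSeries.single ((n : ℤ) - J) (bareCoeff n t₀ t J) * colSum W (j + Fin.ofNat n J)) 0 N 1]
      refine Finset.sum_congr (by ext; simp) fun J hJ => ?_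
      rw [Finset.mem_Ico] at hJ
      rw [colSum_C_smul, colSum_mul_bareH_pow, qPow, ← mul_assoc, ← mul_assoc,
        HahnSeries.single_mul_single, HahnSeries.single_mul_single, bareCoeff, if_neg (by omega)]
      congr 2
      ring
    · rw [← mul_assoc, HahnSeries.single_mul_single, bareCoeff, if_pos rfl,
        show Fin.ofNat n 0 = 0 by ext; simp, add_zero]
      congr 2
      · simp [div_eq_inv_mul]
      · rw [add_zero]
  · rw [← mul_assoc, HahnSeries.single_mul_single, add_zero]
    congr 2
    rw [one_div_mul_eq_div]

theorem coeff_bareD (t₀ : ℂ) (t : Fin N → ℂ) (i j : Fin n) (k : ℤ) :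
    (bareD n t₀ t i j).coeff k = ∑ J ∈ Finset.range (N + 1),
      (if (n : ℤ) * k + j - i = n - J then bareCoeff n t₀ t J else 0) -
        if (n : ℤ) * k + j - i = n then (j : ℕ) / (n : ℂ) else 0 := by
  have h1 : ∀ j, colSum (1 : Mat) j = 1 := fun j => by
    rw [colSum_eq_vecMul, shear_one, Matrix.vecMul_one]
    rfl
  rw [← coeff_colSum, ← one_mul (bareD n t₀ t), colSum_mul_bareD]
  simp only [h1, mul_one, HahnSeries.coeff_sub, HahnSeries.coeff_sum, HahnSeries.coeff_single]
  congr 1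
  · exact Finset.sum_congr rfl fun _ _ => by congr
  · congr

theorem vanishBelow_bareD (r : ℕ) (t₀ : ℂ) (t : Fin (r * n) → ℂ) (hr : 2 ≤ r) (i j : Fin n) :
    VanishBelow (-((r - 1 : ℕ) : ℤ)) (bareD n t₀ t i j) := by
  intro k hk
  have hi := i.2
  have hj := j.2
  have hkn : (n : ℤ) * k + (r * n : ℕ) ≤ 0 := by
    push_cast
    have : k + r ≤ 0 := by omega
    nlinarith
  rw [coeff_bareD, Finset.sum_eq_zero, zero_sub, if_neg, neg_zero]
  · intro h
    omega
  · intro J hJ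
    rw [Finset.mem_range] at hJ
    rw [if_neg]
    intro h
    omega

/-- This is the prescribed `A_r`; at leading order the gauge equation therefore says that `Y_0`
commutes with `A_r`. -/
theorem coeff_bareD_leading (r : ℕ) (t₀ : ℂ) (t : Fin (r * n) → ℂ) (hr : 2 ≤ r) (i j : Fin n) :
    (bareD n t₀ t i j).coeff (-((r - 1 : ℕ) : ℤ)) =
      if i ≤ j then time t (r * n - ((j : ℕ) - (i : ℕ))) / n else 0 := by
  have hi := i.2
  have hj := j.2
  have hkn : (n : ℤ) * -((r - 1 : ℕ) : ℤ) = n - (r * n : ℕ) := by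
    rw [Nat.cast_sub (by omega)]
    push_cast
    ring
  have hrn : 2 * n ≤ r * n := Nat.mul_le_mul_right n hr
  rw [coeff_bareD, hkn]
  rw [if_neg (show ¬ ((n : ℤ) - (r * n : ℕ) + j - i = n) by omega), sub_zero]
  split_ifs with h
  · rw [Fin.le_def] at h
    rw [Finset.sum_eq_single (r * n - ((j : ℕ) - (i : ℕ))), if_pos (by omega), bareCoeff,
      if_neg (by omega)]
    · intro J _ hJ
      rw [if_neg (by omega)]
    · intro hJ
      rw [Finset.mem_range] at hJ
      omega
  · rw [Fin.le_def] at h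
    refine Finset.sum_eq_zero fun J hJ => ?_
    rw [Finset.mem_range] at hJ
    rw [if_neg (by omega)]

theorem ddx_C_mul (c : ℂ) (f : LaurentSeries ℂ) :
    ddx (HahnSeries.C c * f) = HahnSeries.C c * ddx f := by
  ext m
  rw [HahnSeries.C_apply, coeff_ddx, coeff_single_mul', coeff_single_mul', coeff_ddx, sub_zero,
    sub_zero]
  ring

/-- A gauge-fixed connection with times has a normalized formal gauge. -/
theorem exists_normalized_gauge {r : ℕ} (hr : 2 ≤ r) {t : Fin (r * n) → ℂ}
    {A : Matrix (Fin n) (Fin n) (Polynomial ℂ)} (hA : IsGaugeFixed r t A) (ht : HasTimes A t) :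
    ∃ t₀ : ℂ, IsFormalGauge A t₀ t (formalGauge A t) ∧ IsNormalized (formalGauge A t) := by
  refine Classical.epsilon_spec (p := fun Y => ∃ t₀ : ℂ, IsFormalGauge A t₀ t Y ∧
    IsNormalized Y) ?_
  obtain ⟨t₀, Y, hY⟩ := ht
  have hn : (n : ℂ) ≠ 0 := by exact_mod_cast NeZero.ne n
  have hrn : 2 * n ≤ r * n := Nat.mul_le_mul_right n hr
  have hAlow : ∀ i j, VanishBelow (-((r - 1 : ℕ) : ℤ)) (atInfinity A i j) := by
    intro i j m hm
    obtain ⟨k, rfl⟩ : ∃ k : ℕ, m = -k := ⟨m.natAbs, by omega⟩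
    rw [atInfinity, Matrix.map_apply, coeff_aeval_X]
    exact hA.degree _ _ _ (by omega)
  -- Order `x^(r-1)` of the gauge equation; `Y'` has no term there.
  have hcomm : A.map (fun p => p.coeff (r - 1)) * constCoeff Y =
      constCoeff Y * A.map (fun p => p.coeff (r - 1)) := by
    ext i j
    have h := congrArg (fun M => (M i j).coeff (-((r - 1 : ℕ) : ℤ))) hY.gauge
    simp only [Matrix.map_apply, Matrix.sub_apply, Matrix.mul_apply, HahnSeries.coeff_sub,
      HahnSeries.coeff_sum] at h
    rw [coeff_ddx, hY.integral _ _ _ (by omega), mul_zero, neg_zero, eq_comm, sub_eq_zero] at h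
    rw [Matrix.mul_apply, Matrix.mul_apply]
    convert h using 2 with l _ l _
    · have := coeff_mul_lowest (hAlow i l) (hY.integral l j)
      rw [add_zero] at this
      rw [this]
      exact congrArg (· * _) (coeff_aeval_X _ _).symm
    · have := coeff_mul_lowest (hY.integral i l) (vanishBelow_bareD r t₀ t hr l j)
      rw [zero_add] at this
      rw [this, coeff_bareD_leading r t₀ t hr, ← hA.leading]
      rfl
  have hτ : time t (r * n - 1) / n ≠ 0 := div_ne_zero hA.lidskii hn
  obtain ⟨hlow, hdiag⟩ := triangular_of_commute_toeplitz
    (τ := fun d => time t (r * n - d) / n) hτ (fun i j => hA.leading i j) hcomm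
  -- Scaling by a constant preserves the gauge equation, so dividing by the common diagonal entry of
  -- `Y_0` normalizes the gauge.
  set c := constCoeff Y 0 0 with hc
  have hc0 : c ≠ 0 := by
    intro h0
    refine hY.det_ne_zero (Matrix.det_eq_zero_of_column_eq_zero 0 fun i => ?_)
    rcases eq_or_ne i 0 with rfl | hi
    · rw [← hc, h0]
    · exact hlow i 0 (Fin.pos_iff_ne_zero.2 hi)
  have hcoeff : ∀ i j m, (((HahnSeries.C c⁻¹ : LaurentSeries ℂ) • Y) i j).coeff m =
      c⁻¹ * (Y i j).coeff m := fun i j m => by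
    rw [Matrix.smul_apply, smul_eq_mul, HahnSeries.C_apply, coeff_single_mul', sub_zero]
  have hconst : constCoeff ((HahnSeries.C c⁻¹ : LaurentSeries ℂ) • Y) = c⁻¹ • constCoeff Y := by
    ext i j
    exact hcoeff i j 0
  refine ⟨(HahnSeries.C c⁻¹ : LaurentSeries ℂ) • Y, t₀, ⟨?_, ?_, ?_⟩, ?_⟩
  · intro a b m hm
    rw [hcoeff, hY.integral a b m hm, mul_zero]
  · rw [hconst, Matrix.det_smul]
    exact mul_ne_zero (pow_ne_zero _ (inv_ne_zero hc0)) hY.det_ne_zero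
  · rw [mul_laurent_smul, laurent_smul_mul]
    ext1 i j
    simp only [Matrix.map_apply, Matrix.sub_apply, Matrix.smul_apply, smul_eq_mul, ← mul_sub]
    rw [ddx_C_mul]
    congr 1
    exact congrFun (congrFun hY.gauge i) j
  · intro a b hab
    rw [hconst, Matrix.smul_apply, smul_eq_mul]
    rcases hab.lt_or_eq with h | rfl
    · rw [hlow a b h, mul_zero, Matrix.one_apply_ne h.ne']
    · rw [hdiag, Matrix.one_apply_eq, inv_mul_cancel₀ hc0]

end Gauge

/-! ### The spectral branch and the spectral dressing matrix -/

section Spectral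

variable {n : ℕ} [NeZero n] {r : ℕ}

local notation "Mat" => Matrix (Fin n) (Fin n) (LaurentSeries ℂ)

omit [NeZero n] in
theorem coeff_atInfinity (A : Matrix (Fin n) (Fin n) (Polynomial ℂ)) (i j : Fin n) (m : ℕ) :
    (atInfinity A i j).coeff (-(m : ℤ)) = (A i j).coeff m :=
  coeff_aeval_X _ _

omit [NeZero n] in
theorem leading_exponent (hr : 2 ≤ r) : (n : ℤ) * -((r - 1 : ℕ) : ℤ) = n - (r * n : ℕ) := by
  rw [Nat.cast_sub (by omega)]
  push_cast
  ring

section GaugeFixed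

variable {t : Fin (r * n) → ℂ} {A : Matrix (Fin n) (Fin n) (Polynomial ℂ)}

theorem vanishBelow_shear_atInfinity (hr : 2 ≤ r) (hA : IsGaugeFixed r t A) (i j : Fin n) :
    VanishBelow ((n : ℤ) - (r * n : ℕ)) (shear (atInfinity A) i j) := by
  intro m hm
  obtain ⟨i', k, rfl⟩ := exists_index j m
  rcases eq_or_ne i i' with rfl | hi
  · rw [coeff_shear]
    have h1 := i.2
    rw [← leading_exponent hr] at hm
    rcases lt_trichotomy k (-((r - 1 : ℕ) : ℤ)) with hk | hk | hk
    · obtain ⟨p, rfl⟩ : ∃ p : ℕ, k = -p := ⟨k.natAbs, by omega⟩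
      rw [coeff_atInfinity]
      exact hA.degree _ _ _ (by omega)
    · rw [hk, coeff_atInfinity, hA.leading, if_neg]
      rw [Fin.le_def]
      rw [hk] at hm
      omega
    · nlinarith
  · exact coeff_shear_of_ne _ hi j k

theorem coeff_shear_atInfinity_first (hr : 2 ≤ r) (hA : IsGaugeFixed r t A) (i j : Fin n) :
    (shear (atInfinity A) i j).coeff ((n : ℤ) - (r * n : ℕ)) =
      if i = j then time t (r * n) / n else 0 := by
  have e : (n : ℤ) - (r * n : ℕ) = n * -((r - 1 : ℕ) : ℤ) + j - j := by
    rw [leading_exponent hr]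
    ring
  rw [e]
  split_ifs with h
  · subst h
    rw [coeff_shear, coeff_atInfinity, hA.leading, if_pos le_rfl, Nat.sub_self, Nat.sub_zero]
  · exact coeff_shear_of_ne _ h j _

/-- The superdiagonal of `A_r` supplies all entries of the cyclic matrix except the wrap-around one,
which is the lower left entry of `A_{r-1}`. This is where the subleading gauge condition enters. -/
theorem coeff_shear_atInfinity_second (hr : 2 ≤ r) (hA : IsGaugeFixed r t A) (i j : Fin n) :
    (shear (atInfinity A) i j).coeff ((n : ℤ) - (r * n : ℕ) + 1) =
      if i + Fin.ofNat n 1 = j then time t (r * n - 1) / n else 0 := by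
  have hi := i.2
  have hle := leading_exponent (n := n) hr
  obtain ⟨p, rfl⟩ : ∃ p : Fin n, p + Fin.ofNat n 1 = j := ⟨j - Fin.ofNat n 1, by simp⟩
  have hp := p.2
  set j := p + Fin.ofNat n 1 with hj
  have hjv : (j : ℕ) = (p + 1) % n := by
    rw [hj, Fin.val_add, Fin.val_ofNat, Nat.add_mod_mod]
  rcases lt_or_eq_of_le (Nat.succ_le_of_lt hp) with h | h
  · rw [Nat.mod_eq_of_lt h] at hjv
    have e : (n : ℤ) - (r * n : ℕ) + 1 = n * -((r - 1 : ℕ) : ℤ) + j - p := by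
      rw [hle, hjv]
      push_cast
      ring
    rw [e]
    split_ifs with hip
    · obtain rfl := add_right_cancel hip
      rw [coeff_shear, coeff_atInfinity, hA.leading, if_pos (by rw [Fin.le_def]; omega), hjv,
        show (i : ℕ).succ - i = 1 by omega]
    · exact coeff_shear_of_ne _ (fun h' => hip (by rw [h'])) j _
  · rw [show (p : ℕ) + 1 = n from h, Nat.mod_self] at hjv
    have e : (n : ℤ) - (r * n : ℕ) + 1 = n * -((r - 2 : ℕ) : ℤ) + j - p := by
      have : (p : ℤ) = n - 1 := by omega
      rw [← hle, hjv, this, Nat.cast_sub (by omega), Nat.cast_sub (by omega)]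
      push_cast
      ring
    rw [e]
    split_ifs with hip
    · obtain rfl := add_right_cancel hip
      rw [coeff_shear, coeff_atInfinity, hA.subleading _ _ h hjv]
    · exact coeff_shear_of_ne _ (fun h' => hip (by rw [h'])) j _

end GaugeFixed

/-- A row eigenvector `l = (1, …, 1) + O(q⁻¹)` of the sheared matrix `A`, with eigenvalue `y`. -/
structure IsEigenrow {n : ℕ} [NeZero n] (r : ℕ) (A : Matrix (Fin n) (Fin n) (Polynomial ℂ))
    (t : Fin (r * n) → ℂ) (l : Fin n → LaurentSeries ℂ) (y : LaurentSeries ℂ) : Prop where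
  eigen : ∀ j, ∑ i, l i * shear (atInfinity A) i j = y * l j
  integral : ∀ j, VanishBelow 0 (l j)
  coeff_zero : ∀ j, (l j).coeff 0 = 1
  vanish : VanishBelow ((n : ℤ) - (r * n : ℕ)) y
  first : y.coeff ((n : ℤ) - (r * n : ℕ)) = time t (r * n) / n
  second : y.coeff ((n : ℤ) - (r * n : ℕ) + 1) = time t (r * n - 1) / n

variable {t : Fin (r * n) → ℂ} {A : Matrix (Fin n) (Fin n) (Polynomial ℂ)}
  {l : Fin n → LaurentSeries ℂ} {y : LaurentSeries ℂ}

theorem shear_atInfinity_apply (i j : Fin n) : shear (atInfinity A) i j =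
    HahnSeries.single ((j : ℤ) - i) 1 * (A.map (Polynomial.aeval (qPow n))) i j := by
  rw [shear, Matrix.of_apply, atInfinity, Matrix.map_apply, expandHom_aeval, Matrix.map_apply]

/-- Uniqueness of the branch. A column eigenvector `u` for `y' ≠ y` is orthogonal to `l`. At each
order the two leading coefficients of `y'` make the lowest coefficient of `u` cyclically constant,
and pairing with `l = (1, …, 1) + ⋯` makes this constant zero; hence `u = 0`. -/
theorem IsSpectralBranch.eq_of_isEigenrow (hr : 2 ≤ r) (hA : IsGaugeFixed r t A)
    (hl : IsEigenrow r A t l y) {y' : LaurentSeries ℂ} (hy' : IsSpectralBranch A t y') :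
    y' = y := by
  have hn : (n : ℂ) ≠ 0 := by exact_mod_cast NeZero.ne n
  have hrn : 2 * n ≤ r * n := Nat.mul_le_mul_right n hr
  have hn0 := NeZero.pos n
  obtain ⟨hdet, hco⟩ := hy'
  rw [Matrix.eval_charpoly, ← Matrix.exists_mulVec_eq_zero_iff] at hdet
  obtain ⟨v, hv0, hv⟩ := hdet
  set N : ℤ := (n : ℤ) - (r * n : ℕ) with hN
  have hyN : VanishBelow N y' := by
    intro m hm
    obtain ⟨J, rfl⟩ : ∃ J : ℕ, m = n - J := ⟨(n - m).toNat, by omega⟩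
    rw [hco J (by omega), time, dif_neg (by omega), zero_div]
  have hy0 : y'.coeff N = time t (r * n) / n := hco _ (by omega)
  have hy1 : y'.coeff (N + 1) = time t (r * n - 1) / n := by
    rw [← hco _ (by omega)]
    congr 1
    omega
  set S := shear (atInfinity A) with hS
  set u : Fin n → LaurentSeries ℂ := fun i => HahnSeries.single (-(i : ℤ)) 1 * v i with hu
  have hSu : ∀ i, ∑ j, S i j * u j = y' * u i := by
    intro i
    have h1 := congrFun hv i
    rw [Matrix.sub_mulVec, Pi.sub_apply, Pi.zero_apply, sub_eq_zero] at h1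
    simp only [Matrix.mulVec, dotProduct, Matrix.scalar_apply, Matrix.diagonal_apply, ite_mul,
      zero_mul, Finset.sum_ite_eq, Finset.mem_univ, if_true] at h1
    rw [hu]
    simp only
    rw [mul_left_comm, h1, Finset.mul_sum]
    refine Finset.sum_congr rfl fun j _ => ?_
    rw [hS, shear_atInfinity_apply, mul_mul_mul_comm, HahnSeries.single_mul_single, mul_one,
      show (j : ℤ) - i + -j = -i by ring]
  by_contra hne
  have horth : ∑ i, l i * u i = 0 := by
    have h1 : y * ∑ i, l i * u i = y' * ∑ i, l i * u i := by
      calc y * ∑ i, l i * u i = ∑ j, (∑ i, l i * S i j) * u j := by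
            rw [Finset.mul_sum]
            exact Finset.sum_congr rfl fun j _ => by rw [hl.eigen, mul_assoc]
        _ = ∑ i, l i * ∑ j, S i j * u j := by
            simp only [Finset.sum_mul, Finset.mul_sum]
            rw [Finset.sum_comm]
            exact Finset.sum_congr rfl fun i _ => Finset.sum_congr rfl fun j _ => mul_assoc _ _ _
        _ = y' * ∑ i, l i * u i := by
            rw [Finset.mul_sum]
            exact Finset.sum_congr rfl fun i _ => by rw [hSu, mul_left_comm]
    rw [← sub_eq_zero, ← sub_mul, mul_eq_zero, sub_eq_zero] at h1
    exact h1.resolve_left fun h => hne h.symm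
  have step : ∀ m : ℤ, (∀ i, VanishBelow m (u i)) → ∀ i, VanishBelow (m + 1) (u i) := by
    intro m hm
    have hinv : ∀ i, (u (i + Fin.ofNat n 1)).coeff m = (u i).coeff m := by
      intro i
      have h1 := congrArg (fun f => f.coeff (N + m + 1)) (hSu i)
      simp only [HahnSeries.coeff_sum] at h1
      rw [coeff_mul_second hyN (hm i), hy0, hy1] at h1
      have h2 : ∀ j, (S i j * u j).coeff (N + m + 1) =
          (if i = j then time t (r * n) / n * (u i).coeff (m + 1) else 0) +
            if i + Fin.ofNat n 1 = j then time t (r * n - 1) / n * (u j).coeff m else 0 := by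
        intro j
        rw [coeff_mul_second (vanishBelow_shear_atInfinity hr hA i j) (hm j),
          coeff_shear_atInfinity_first hr hA, coeff_shear_atInfinity_second hr hA]
        congr 1
        · split_ifs with h
          · rw [h]
          · rw [zero_mul]
        · rw [ite_mul, zero_mul]
      simp only [h2, Finset.sum_add_distrib, Finset.sum_ite_eq, Finset.mem_univ, if_true] at h1
      exact mul_left_cancel₀ (div_ne_zero hA.lidskii hn) (add_left_cancel h1)
    have hconst := eq_of_cyclic_invariant (f := fun i => (u i).coeff m) hinv
    have hzero : (u 0).coeff m = 0 := by
      have h1 := congrArg (fun f => f.coeff (0 + m)) horth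
      simp only [HahnSeries.coeff_sum, HahnSeries.coeff_zero] at h1
      have h2 : ∀ i, (l i * u i).coeff (0 + m) = (u 0).coeff m := fun i => by
        rw [coeff_mul_lowest (hl.integral i) (hm i), hl.coeff_zero, one_mul, ← hconst i]
      simp only [h2, Finset.sum_const, Finset.card_univ, Fintype.card_fin, nsmul_eq_mul,
        mul_eq_zero] at h1
      exact h1.resolve_left hn
    intro i p hp
    rcases lt_or_eq_of_le (show p ≤ m by omega) with h | rfl
    · exact hm i p h
    · exact (hconst i).trans hzero
  choose b hb using fun i => exists_vanishBelow (u i)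
  obtain ⟨m₀, hm₀⟩ : ∃ m₀ : ℤ, ∀ i, m₀ ≤ b i := by
    obtain ⟨i₀, hi₀⟩ := Finite.exists_min b
    exact ⟨b i₀, hi₀⟩
  have hall : ∀ k : ℕ, ∀ i, VanishBelow (m₀ + k) (u i) := by
    intro k
    induction k with
    | zero => exact fun i => (hb i).mono (by simpa using hm₀ i)
    | succ k ih => exact fun i => by simpa [add_assoc] using step _ ih i
  refine hv0 (funext fun i => ?_)
  have hui : u i = 0 := by
    ext p
    exact hall (p - m₀ + 1).toNat i p (by omega)
  exact (mul_eq_zero.1 hui).resolve_left (HahnSeries.single_ne_zero one_ne_zero)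

/-- The eigenvector equation is this identity read on column sums: `Z = unshear l` conjugates `A` to
`y(𝓗)`. -/
theorem unshear_mul_atInfinity (hl : IsEigenrow r A t l y) :
    unshear l * atInfinity A = mulMat n y * unshear l := by
  apply colSum_injective
  rw [colSum_mul, colSum_mulMat_mul, colSum_unshear]
  exact funext hl.eigen

/-- A derivative has no `x⁻¹` term, so `Y' = O(x⁻²)`; shearing costs at most `n - 1` of the `2n`
orders in `1/q`. -/
theorem vanishBelow_shear_ddx {Y : Mat} (hY : ∀ a b m, m < 0 → (Y a b).coeff m = 0) (i j : Fin n) :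
    VanishBelow (n : ℤ) (shear (Y.map ddx) i j) := by
  intro m hm
  obtain ⟨i', k, rfl⟩ := exists_index j m
  rcases eq_or_ne i i' with rfl | h
  · rw [coeff_shear, Matrix.map_apply, coeff_ddx]
    have hi := i.2
    rcases eq_or_ne k 1 with rfl | hk
    · simp
    · have hk' : k < 2 := by
        by_contra hk'
        nlinarith
      rw [hY _ _ _ (by omega), mul_zero, neg_zero]
  · exact coeff_shear_of_ne _ h j k

theorem IsEigenrow.isUnipotent (hl : IsEigenrow r A t l y) : IsUnipotent (unshear l) :=
  IsUnipotent.unshear hl.integral hl.coeff_zero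

/-- The spectral and the formal dressing matrices agree to high order. -/
theorem IsEigenrow.rigidity (hr : 2 ≤ r) (hA : IsGaugeFixed r t A) (hl : IsEigenrow r A t l y)
    {t₀ : ℂ} {Y : Mat} (hY : IsFormalGauge A t₀ t Y) (hN : IsNormalized Y) :
    (∀ j, VanishBelow ((r * n : ℕ) - 1) (colSum (unshear l * Y) j - colSum (unshear l * Y) 0)) ∧
      ∀ J : ℕ, 1 ≤ J → y.coeff ((n : ℤ) - J) = time t J / n := by
  have hn : (n : ℂ) ≠ 0 := by exact_mod_cast NeZero.ne n
  have hrn : 2 * n ≤ r * n := Nat.mul_le_mul_right n hr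
  have hn0 := NeZero.pos n
  have hW : IsUnipotent (unshear l * Y) :=
    hl.isUnipotent.mul (IsUnipotent.of_isNormalized hY.integral hN)
  set W := unshear l * Y with hWdef
  have hgauge : mulMat n y * W - W * bareD n t₀ t = unshear l * Y.map ddx := by
    rw [hY.gauge, mul_sub, hWdef, ← mul_assoc, ← mul_assoc, unshear_mul_atInfinity hl, mul_assoc,
      mul_assoc]
  have hω : ∀ j, VanishBelow 0 (colSum W j) := fun j =>
    vanishBelow_colSum fun i => hW.integral i j
  have hω0 : ∀ j, (colSum W j).coeff 0 = 1 := fun j => by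
    rw [colSum, HahnSeries.coeff_sum]
    simp [hW.coeff_zero, Matrix.one_apply]
  -- `Z Y'` and the `G` term are both `O(q^(-n))`; discarding them leaves a pure shift operator with
  -- constant coefficients.
  have hsmall : ∀ j, VanishBelow (n : ℤ) (y * colSum W j - ∑ J ∈ Finset.range (r * n + 1),
      HahnSeries.single ((n : ℤ) - J) (bareCoeff n t₀ t J) * colSum W (j + Fin.ofNat n J)) := by
    intro j
    have h1 := congrFun (congrArg colSum hgauge) j
    rw [colSum_sub, Pi.sub_apply, colSum_mulMat_mul, colSum_mul_bareD, Pi.smul_apply,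
      smul_eq_mul] at h1
    have h2 : VanishBelow (n : ℤ) (colSum (unshear l * Y.map ddx) j) := by
      refine vanishBelow_colSum fun i => ?_
      rw [shear_mul]
      simpa using vanishBelow_matrix_mul hl.isUnipotent.integral
        (vanishBelow_shear_ddx hY.integral) i j
    have h3 := (hω j).single_mul (n : ℤ) ((j : ℕ) / (n : ℂ))
    rw [add_zero] at h3
    have h4 := h2.sub h3
    rwa [← h1, sub_sub, sub_add_cancel] at h4
  obtain ⟨M, hM⟩ : ∃ M, r * n = M + 2 := ⟨r * n - 2, by omega⟩
  have hofNat : Fin.ofNat n (M + 2) = 0 := by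
    rw [← hM]
    ext
    simp
  have hc1 : bareCoeff n t₀ t (M + 1) = time t (r * n - 1) / n := by
    rw [show M + 1 = r * n - 1 by omega, bareCoeff, if_neg (by omega)]
  have hc2 : bareCoeff n t₀ t (M + 2) = time t (r * n) / n := by
    rw [← hM, bareCoeff, if_neg (by omega)]
  have hyv := hl.vanish
  have hy0 := hl.first
  have hy1 := hl.second
  rw [← hc2] at hy0
  rw [← hc1] at hy1
  have hc : bareCoeff n t₀ t (M + 1) ≠ 0 := by
    rw [hc1]
    exact div_ne_zero hA.lidskii hn
  simp only [hM] at hsmall hyv hy0 hy1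
  obtain ⟨h1, h2⟩ := eigenrow_rigidity (bareCoeff n t₀ t) hofNat hc rfl hω hω0 hyv hy0 hy1 hsmall
  constructor
  · intro j
    convert h1 j using 1
    rw [hM]
    push_cast
    ring
  · intro J hJ
    have h3 := h2 (n - J) (by omega)
    rw [HahnSeries.coeff_sub, sub_eq_zero] at h3
    rw [h3, HahnSeries.coeff_sum]
    rcases lt_or_ge J (M + 3) with hlt | hge
    · rw [Finset.sum_eq_single J, HahnSeries.coeff_single_same, bareCoeff, if_neg (by omega)]
      · intro J' _ hJ'
        exact HahnSeries.coeff_single_of_ne (by omega)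
      · intro h
        exact absurd (Finset.mem_range.2 hlt) h
    · rw [Finset.sum_eq_zero, time, dif_neg (by omega), zero_div]
      intro J' hJ'
      rw [Finset.mem_range] at hJ'
      exact HahnSeries.coeff_single_of_ne (by omega)

theorem IsEigenrow.isSpectralBranch (hr : 2 ≤ r) (hA : IsGaugeFixed r t A)
    (hl : IsEigenrow r A t l y) {t₀ : ℂ} {Y : Mat} (hY : IsFormalGauge A t₀ t Y)
    (hN : IsNormalized Y) : IsSpectralBranch A t y := by
  refine ⟨?_, (hl.rigidity hr hA hY hN).2⟩
  rw [Matrix.eval_charpoly, ← Matrix.exists_vecMul_eq_zero_iff]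
  refine ⟨fun i => HahnSeries.single (-(i : ℤ)) 1 * l i, fun h => ?_, ?_⟩
  · have h0 := (mul_eq_zero.1 (congrFun h 0)).resolve_left (HahnSeries.single_ne_zero one_ne_zero)
    have h1 := hl.coeff_zero 0
    rw [h0] at h1
    exact zero_ne_one h1
  · ext1 j
    rw [Matrix.vecMul_sub, Pi.sub_apply, Pi.zero_apply, sub_eq_zero]
    simp only [Matrix.vecMul, dotProduct, Matrix.scalar_apply, Matrix.diagonal_apply, mul_ite,
      mul_zero, Finset.sum_ite_eq', Finset.mem_univ, if_true]
    have h1 := hl.eigen j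
    simp only [shear_atInfinity_apply] at h1
    have h2 := congrArg (fun f => HahnSeries.single (-(j : ℤ)) (1 : ℂ) * f) h1
    simp only [Finset.mul_sum] at h2
    rw [mul_assoc, mul_comm (l j) y, ← h2]
    refine Finset.sum_congr rfl fun i _ => ?_
    rw [mul_left_comm (l i), ← mul_assoc, HahnSeries.single_mul_single, mul_one, ← mul_assoc]
    congr 4
    ring

theorem IsEigenrow.spectralBranch_eq (hr : 2 ≤ r) (hA : IsGaugeFixed r t A) (ht : HasTimes A t)
    (hl : IsEigenrow r A t l y) : spectralBranch A t = y := by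
  obtain ⟨t₀, hY, hN⟩ := exists_normalized_gauge hr hA ht
  exact IsSpectralBranch.eq_of_isEigenrow hr hA hl
    (Classical.epsilon_spec (p := fun y => IsSpectralBranch A t y)
      ⟨y, hl.isSpectralBranch hr hA hY hN⟩)

/-- The matrix `Z⁻¹ 𝓗 ^ J Z` for the spectral dressing matrix `Z`. -/
def dressed {n : ℕ} [NeZero n] (l : Fin n → LaurentSeries ℂ) (J : ℕ) :
    Matrix (Fin n) (Fin n) (LaurentSeries ℂ) :=
  (unshear l)⁻¹ * bareH n ^ J * unshear l

/-- With `W = Z Y`, the difference of the spectral and formal dressings is `Z⁻¹ (𝓗^J W - W 𝓗^J)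
Y⁻¹`. Rigidity makes the commutator integral after shearing, so the polynomial parts differ by
constants. -/
theorem IsEigenrow.ddx_deform (hr : 2 ≤ r) (hA : IsGaugeFixed r t A) (ht : HasTimes A t)
    (hl : IsEigenrow r A t l y) {J : ℕ} (hJ : J ≤ r * n) :
    atInfinity ((deform A t J).map Polynomial.derivative) =
      (HahnSeries.C (1 / (J : ℂ)) : LaurentSeries ℂ) •
        ((dressed l J).map nonnegPart).map ddx := by
  obtain ⟨t₀, hY, hN⟩ := exists_normalized_gauge hr hA ht
  set Y := formalGauge A t with hYdef
  set Z := unshear l with hZ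
  have hZu := hl.isUnipotent
  have hYu := IsUnipotent.of_isNormalized hY.integral hN
  set Q := bareH n ^ J * (Z * Y) - (Z * Y) * bareH n ^ J with hQ
  have hQcol : ∀ j, VanishBelow 0 (colSum Q j) := by
    intro j
    rw [hQ, colSum_sub, Pi.sub_apply, colSum_mul_bareH_pow, bareH_pow_eq_mulMat, colSum_mulMat_mul,
      Pi.smul_apply, smul_eq_mul, ← mul_sub]
    have hrig := (hl.rigidity hr hA hY hN).1
    rcases Nat.lt_or_eq_of_le hJ with h | rfl
    · have h1 := ((hrig j).sub (hrig (j + Fin.ofNat n J))).single_mul (-(J : ℤ)) 1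
      rw [sub_sub_sub_cancel_right] at h1
      exact h1.mono (by omega)
    -- For `J = rn` the rigidity bound is one order short, but the shift by `rn` is trivial and the
    -- commutator vanishes.
    · rw [show Fin.ofNat n (r * n) = 0 by ext; simp, add_zero, sub_self, mul_zero]
      exact vanishBelow_zero
  have hdiff : dressed l J - Y * bareH n ^ J * Y⁻¹ = Z⁻¹ * Q * Y⁻¹ := by
    have e1 : Z⁻¹ * Z = 1 := Matrix.nonsing_inv_mul _ hZu.isUnit_det
    have e2 : Y * Y⁻¹ = 1 := Matrix.mul_nonsing_inv _ hYu.isUnit_det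
    have e3 : Z⁻¹ * (bareH n ^ J * (Z * Y)) * Y⁻¹ = dressed l J * (Y * Y⁻¹) := by
      simp only [dressed, ← hZ, mul_assoc]
    have e4 : Z⁻¹ * ((Z * Y) * bareH n ^ J) * Y⁻¹ = (Z⁻¹ * Z) * (Y * bareH n ^ J * Y⁻¹) := by
      simp only [mul_assoc]
    rw [hQ, mul_sub, sub_mul, e3, e4, e1, e2, mul_one, one_mul]
  have hint : ∀ i j, VanishBelow 0 ((dressed l J - Y * bareH n ^ J * Y⁻¹) i j) := by
    intro i j
    apply vanishBelow_of_shear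
    rw [hdiff, shear_mul, shear_mul]
    have := vanishBelow_matrix_mul (vanishBelow_matrix_mul hZu.integral_inv
      (vanishBelow_shear hQcol)) hYu.integral_inv i j
    simpa using this
  ext1 i j
  have h1 := ddx_nonnegPart_eq_of_vanishBelow (hint i j)
  rw [Matrix.smul_apply, Matrix.map_apply, Matrix.map_apply, h1, smul_eq_mul, atInfinity,
    Matrix.map_apply, Matrix.map_apply, deform, Matrix.smul_apply, Polynomial.smul_eq_C_mul,
    Polynomial.derivative_C_mul, map_mul, Polynomial.aeval_C, algebraMap_eq_C, Matrix.map_apply,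
    nonnegPart, ddx_aeval_X, ← hYdef]

end Spectral

/-! ### Holomorphic dependence on parameters -/

/-- The ring of holomorphic functions on `U`. -/
def holoRing {N : ℕ} (U : Set (Fin N → ℂ)) : Subring (U → ℂ) where
  carrier := {f | ∃ g : (Fin N → ℂ) → ℂ, DifferentiableOn ℂ g U ∧ ∀ u : U, g u = f u}
  mul_mem' := by
    rintro f f' ⟨g, hg, h⟩ ⟨g', hg', h'⟩
    exact ⟨fun t => g t * g' t, hg.mul hg', fun u => by simp [h, h']⟩
  one_mem' := ⟨fun _ => 1, differentiableOn_const _, fun _ => rfl⟩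
  add_mem' := by
    rintro f f' ⟨g, hg, h⟩ ⟨g', hg', h'⟩
    exact ⟨fun t => g t + g' t, hg.add hg', fun u => by simp [h, h']⟩
  zero_mem' := ⟨fun _ => 0, differentiableOn_const _, fun _ => rfl⟩
  neg_mem' := by
    rintro f ⟨g, hg, h⟩
    exact ⟨fun t => -g t, hg.neg, fun u => by simp [h]⟩

section HoloRing

variable {N : ℕ} {U : Set (Fin N → ℂ)}

/-- A holomorphic function as an element of `holoRing U`. -/
def toHolo (g : (Fin N → ℂ) → ℂ) (hg : DifferentiableOn ℂ g U) : holoRing U :=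
  ⟨fun u => g u, g, hg, fun _ => rfl⟩

theorem isUnit_toHolo {g : (Fin N → ℂ) → ℂ} (hg : DifferentiableOn ℂ g U)
    (h : ∀ u ∈ U, g u ≠ 0) : IsUnit (toHolo g hg) := by
  rw [isUnit_iff_exists_inv]
  refine ⟨toHolo (fun t => (g t)⁻¹) (hg.inv h), ?_⟩
  ext u
  exact mul_inv_cancel₀ (h u u.2)

theorem isUnit_natCast_holoRing {n : ℕ} [NeZero n] : IsUnit (n : holoRing U) := by
  have : (n : holoRing U) = toHolo (fun _ => (n : ℂ)) (differentiableOn_const _) := by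
    ext u
    rfl
  rw [this]
  exact isUnit_toHolo _ fun _ _ => by exact_mod_cast NeZero.ne n

/-- Evaluation at a point. -/
def evalAt (u : U) : holoRing U →+* ℂ := (Pi.evalRingHom _ u).comp (holoRing U).subtype

open scoped Classical in
/-- Extension by zero. -/
def extendZero (f : holoRing U) (t : Fin N → ℂ) : ℂ := if h : t ∈ U then (f : U → ℂ) ⟨t, h⟩ else 0

theorem extendZero_apply (f : holoRing U) (u : U) : extendZero f u = evalAt u f := by
  rw [extendZero, dif_pos u.2]
  rfl

theorem differentiableOn_extendZero (f : holoRing U) : DifferentiableOn ℂ (extendZero f) U := by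
  obtain ⟨g, hg, h⟩ := f.2
  refine hg.congr fun t ht => ?_
  rw [extendZero, dif_pos ht, h ⟨t, ht⟩]

variable (hU : IsOpen U)
include hU

theorem differentiableAt_extendZero (f : holoRing U) (u : U) :
    DifferentiableAt ℂ (extendZero f) u :=
  (differentiableOn_extendZero f).differentiableAt (hU.mem_nhds u.2)

/-- The derivative at a point in a given direction. -/
def derivAt (u : U) (v : Fin N → ℂ) : holoRing U →+ ℂ where
  toFun f := fderiv ℂ (extendZero f) u v
  map_zero' := by
    have : extendZero (0 : holoRing U) = fun _ => 0 := by
      ext t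
      rw [extendZero]
      split_ifs <;> rfl
    rw [this, fderiv_fun_const]
    rfl
  map_add' f g := by
    have : extendZero (f + g) = extendZero f + extendZero g := by
      ext t
      simp only [extendZero, Pi.add_apply]
      split_ifs
      · rfl
      · rw [add_zero]
    rw [this, fderiv_add (differentiableAt_extendZero hU f u) (differentiableAt_extendZero hU g u)]
    rfl

theorem derivAt_apply (u : U) (v : Fin N → ℂ) (f : holoRing U) :
    derivAt hU u v f = fderiv ℂ (extendZero f) u v := rfl

theorem derivAt_mul (u : U) (v : Fin N → ℂ) (f g : holoRing U) :
    derivAt hU u v (f * g) = derivAt hU u v f * evalAt u g + evalAt u f * derivAt hU u v g := by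
  have : extendZero (f * g) = extendZero f * extendZero g := by
    ext t
    simp only [extendZero, Pi.mul_apply]
    split_ifs
    · rfl
    · rw [mul_zero]
  rw [derivAt_apply, this, fderiv_mul (differentiableAt_extendZero hU f u)
    (differentiableAt_extendZero hU g u), extendZero_apply, extendZero_apply]
  simp only [add_apply, smul_apply, smul_eq_mul,
    derivAt_apply]
  ring

theorem derivAt_toHolo (u : U) (v : Fin N → ℂ) {g : (Fin N → ℂ) → ℂ} (hg : DifferentiableOn ℂ g U) :
    derivAt hU u v (toHolo g hg) = fderiv ℂ g u v := by
  rw [derivAt_apply]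
  congr 1
  refine Filter.EventuallyEq.fderiv_eq ?_
  filter_upwards [hU.mem_nhds u.2] with t ht
  rw [extendZero, dif_pos ht]
  rfl

end HoloRing

/-! ### Evaluation and differentiation of Laurent series coefficient by coefficient. -/

section LaurentMaps

variable {k : Type*} [CommRing k]

theorem VanishBelow.map {f : LaurentSeries k} {a : ℤ} (hf : VanishBelow a f) (D : k →+ ℂ) :
    VanishBelow a (f.map D) := fun m hm => by
  rw [HahnSeries.map_coeff, hf m hm, map_zero]

theorem map_laurent_mul (ev : k →+* ℂ) (f g : LaurentSeries k) :
    (f * g).map ev = f.map ev * g.map ev :=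
  HahnSeries.map_mul (ev : k →ₙ+* ℂ)

theorem map_laurent_sum {ι : Type*} (D : k →+ ℂ) (s : Finset ι) (f : ι → LaurentSeries k) :
    (∑ i ∈ s, f i).map D = ∑ i ∈ s, (f i).map D := by
  ext m
  simp only [HahnSeries.map_coeff, HahnSeries.coeff_sum, map_sum]

theorem map_laurent_leibniz {ev : k →+* ℂ} {D : k →+ ℂ}
    (hD : ∀ a b, D (a * b) = D a * ev b + ev a * D b) (f g : LaurentSeries k) :
    (f * g).map D = f.map D * g.map ev + f.map ev * g.map D := by
  obtain ⟨a, hf⟩ := exists_vanishBelow f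
  obtain ⟨b, hg⟩ := exists_vanishBelow g
  have hfe : VanishBelow a (f.map ev) := hf.map (ev : k →+ ℂ)
  have hge : VanishBelow b (g.map ev) := hg.map (ev : k →+ ℂ)
  ext m
  rw [HahnSeries.map_coeff, HahnSeries.coeff_add, coeff_mul_eq_sum hf hg,
    coeff_mul_eq_sum (hf.map D) hge, coeff_mul_eq_sum hfe (hg.map D), map_sum,
    ← Finset.sum_add_distrib]
  exact Finset.sum_congr rfl fun i _ => hD _ _

end LaurentMaps

/-! ### First variation of the eigenvalue. -/

section Derivative

variable {n : ℕ} [NeZero n]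

local notation "Mat" => Matrix (Fin n) (Fin n) (LaurentSeries ℂ)

/-- A form in which the coefficients of `A` appear linearly, so that they can be replaced by
holomorphic functions or by their derivatives. -/
theorem shear_atInfinity_eq_sum {r : ℕ} {A : Matrix (Fin n) (Fin n) (Polynomial ℂ)}
    (hA : ∀ i j m, r ≤ m → (A i j).coeff m = 0) (i j : Fin n) :
    shear (atInfinity A) i j = ∑ m ∈ Finset.range r,
      HahnSeries.single ((j : ℤ) - i - n * m) ((A i j).coeff m) := by
  have h : A i j = ∑ m ∈ Finset.range r, Polynomial.monomial m ((A i j).coeff m) := by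
    ext p
    simp only [Polynomial.finsetSum_coeff, Polynomial.coeff_monomial, Finset.sum_ite_eq',
      Finset.mem_range]
    split_ifs with hp
    · rfl
    · exact hA i j p (not_lt.1 hp)
  have h2 : atInfinity A i j = ∑ m ∈ Finset.range r,
      HahnSeries.single (-(m : ℤ)) ((A i j).coeff m) := by
    rw [atInfinity, Matrix.map_apply]
    conv_lhs => rw [h]
    simp only [map_sum, aeval_X_monomial]
  rw [shear, Matrix.of_apply, h2, map_sum, Finset.mul_sum]
  refine Finset.sum_congr rfl fun m _ => ?_
  rw [expandHom_single, HahnSeries.single_mul_single, one_mul]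
  congr 2
  ring

/-- First variation of the eigenvalue, in terms of the spectral dressing matrix. -/
theorem IsEigenrow.trace_variation {r : ℕ} {t : Fin (r * n) → ℂ}
    {A A' : Matrix (Fin n) (Fin n) (Polynomial ℂ)} {l l' : Fin n → LaurentSeries ℂ}
    {y y' : LaurentSeries ℂ} (hl : IsEigenrow r A t l y)
    (h : ∀ j, ∑ i, (l' i * shear (atInfinity A) i j + l i * shear (atInfinity A') i j) =
      y' * l j + y * l' j) (K : ℕ) :
    (dressed l K * atInfinity A').trace.coeff 1 = n * y'.coeff (n + K) := by
  set Z := unshear l with hZ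
  set Z' := unshear l' with hZ'
  have hinv : Z⁻¹ * Z = 1 := Matrix.nonsing_inv_mul _ hl.isUnipotent.isUnit_det
  have hinv' : Z * Z⁻¹ = 1 := Matrix.mul_nonsing_inv _ hl.isUnipotent.isUnit_det
  have hvar : Z' * atInfinity A + Z * atInfinity A' = mulMat n y' * Z + mulMat n y * Z' := by
    apply colSum_injective
    rw [colSum_add, colSum_add, colSum_mul, colSum_mul, colSum_mulMat_mul, colSum_mulMat_mul, hZ,
      hZ', colSum_unshear, colSum_unshear]
    ext1 j
    simp only [Pi.add_apply, Matrix.vecMul, dotProduct, Pi.smul_apply, smul_eq_mul,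
      ← Finset.sum_add_distrib]
    exact h j
  have hA : atInfinity A * Z⁻¹ = Z⁻¹ * mulMat n y := by
    have := unshear_mul_atInfinity hl
    rw [← hZ] at this
    calc atInfinity A * Z⁻¹ = Z⁻¹ * Z * atInfinity A * Z⁻¹ := by rw [hinv, one_mul]
      _ = Z⁻¹ * (Z * atInfinity A) * Z⁻¹ := by rw [mul_assoc Z⁻¹]
      _ = Z⁻¹ * mulMat n y * (Z * Z⁻¹) := by rw [this]; simp only [mul_assoc]
      _ = Z⁻¹ * mulMat n y := by rw [hinv', mul_one]
  have e1 : dressed l K * atInfinity A' = Z⁻¹ * (mulMat n (qPow K) * mulMat n y') * Z +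
      Z⁻¹ * (mulMat n (qPow K) * mulMat n y) * Z' -
        Z⁻¹ * mulMat n (qPow K) * Z' * atInfinity A := by
    have : Z * atInfinity A' = mulMat n y' * Z + mulMat n y * Z' - Z' * atInfinity A :=
      eq_sub_of_add_eq' hvar
    rw [dressed, ← hZ, mul_assoc, this, bareH_pow_eq_mulMat]
    simp only [mul_add, mul_sub, mul_assoc]
  -- The variation `Z'` of the eigenvector drops out of the trace by cyclicity and `A Z⁻¹ = Z⁻¹
  -- y(𝓗)`. What remains is the trace of `(q^K y')(𝓗)`, whose `x⁻¹` coefficient is `n` times the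
  -- `q^(-n)` coefficient of `q^K y'`.
  have e2 : (Z⁻¹ * mulMat n (qPow K) * Z' * atInfinity A).trace =
      (Z⁻¹ * (mulMat n (qPow K) * mulMat n y) * Z').trace := by
    rw [Matrix.trace_mul_comm, ← mul_assoc, ← mul_assoc, hA, mul_assoc Z⁻¹, ← mulMat_mul,
      ← mulMat_mul, mul_comm]
  rw [e1, Matrix.trace_sub, Matrix.trace_add, e2, add_sub_cancel_right, Matrix.trace_mul_comm,
    ← mul_assoc, hinv', one_mul, ← mulMat_mul, coeff_trace_mulMat, qPow, coeff_single_mul',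
    one_mul, mul_one, sub_neg_eq_add]

omit [NeZero n] in
theorem atInfinity_mul (A B : Matrix (Fin n) (Fin n) (Polynomial ℂ)) :
    atInfinity (A * B) = atInfinity A * atInfinity B :=
  Matrix.map_mul (f := (Polynomial.aeval X : Polynomial ℂ →ₐ[ℂ] LaurentSeries ℂ))

omit [NeZero n] in
theorem atInfinity_add (A B : Matrix (Fin n) (Fin n) (Polynomial ℂ)) :
    atInfinity (A + B) = atInfinity A + atInfinity B :=
  Matrix.map_add _ (map_add _) A B

omit [NeZero n] in
theorem atInfinity_sub (A B : Matrix (Fin n) (Fin n) (Polynomial ℂ)) :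
    atInfinity (A - B) = atInfinity A - atInfinity B :=
  Matrix.map_sub _ (map_sub _) A B

/-- Both `dressed l K` and `A` are conjugates by `Z` of functions of `𝓗`, so they commute, and
cyclicity of the trace applies. -/
theorem IsEigenrow.trace_dressed_commutator {r : ℕ} {t : Fin (r * n) → ℂ}
    {A : Matrix (Fin n) (Fin n) (Polynomial ℂ)} {l : Fin n → LaurentSeries ℂ}
    {y : LaurentSeries ℂ} (hl : IsEigenrow r A t l y) (T : Matrix (Fin n) (Fin n) (Polynomial ℂ))
    (K : ℕ) : (dressed l K * atInfinity (T * A - A * T)).trace = 0 := by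
  have hinv' : unshear l * (unshear l)⁻¹ = 1 :=
    Matrix.mul_nonsing_inv _ hl.isUnipotent.isUnit_det
  have hinv : (unshear l)⁻¹ * unshear l = 1 :=
    Matrix.nonsing_inv_mul _ hl.isUnipotent.isUnit_det
  have hA : atInfinity A = (unshear l)⁻¹ * mulMat n y * unshear l := by
    rw [mul_assoc, ← unshear_mul_atInfinity hl, ← mul_assoc, hinv, one_mul]
  have hconj : ∀ P Q : Mat, ((unshear l)⁻¹ * P * unshear l) * ((unshear l)⁻¹ * Q * unshear l) =
      (unshear l)⁻¹ * (P * Q) * unshear l := by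
    intro P Q
    calc _ = (unshear l)⁻¹ * P * (unshear l * (unshear l)⁻¹) * Q * unshear l := by
          simp only [mul_assoc]
      _ = _ := by
          rw [hinv', mul_one]
          simp only [mul_assoc]
  have hcomm : dressed l K * atInfinity A = atInfinity A * dressed l K := by
    rw [hA, dressed, hconj, hconj, bareH_pow_eq_mulMat, ← mulMat_mul, ← mulMat_mul, mul_comm y]
  rw [atInfinity_sub, atInfinity_mul, atInfinity_mul, mul_sub, Matrix.trace_sub, ← mul_assoc,
    ← mul_assoc, hcomm, Matrix.trace_mul_comm, ← mul_assoc, sub_self]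

end Derivative

/-! ### Deformations -/

section Deformation

variable {n : ℕ} [NeZero n] {r : ℕ} {U : Set (Fin (r * n) → ℂ)}
  {A : (Fin (r * n) → ℂ) → Matrix (Fin n) (Fin n) (Polynomial ℂ)}

omit [NeZero n] in
theorem differentiable_time (J : ℕ) :
    Differentiable ℂ fun t : Fin (r * n) → ℂ => time t J := by
  unfold time
  split_ifs with h
  · fun_prop
  · fun_prop

/-- The row eigenvector and the eigenvalue of a deformation depend holomorphically on the times. -/
theorem IsDeformation.exists_eigenrow (hr : 2 ≤ r) (hU : IsOpen U) (hA : IsDeformation n r U A) :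
    ∃ (l : Fin n → LaurentSeries (holoRing U)) (y : LaurentSeries (holoRing U)),
      (∀ u : U, IsEigenrow r (A u) u (fun j => (l j).map (evalAt u)) (y.map (evalAt u))) ∧
      ∀ (u : U) (k : Fin (r * n)) (K : ℕ),
        (dressed (fun j => (l j).map (evalAt u)) K *
          atInfinity ((deform (A u) (u : Fin (r * n) → ℂ) (k + 1)).map Polynomial.derivative)).trace.coeff 1 =
        n * derivAt hU u (Pi.single k 1) (y.coeff (n + K)) := by
  -- The sheared connection with coefficients in `holoRing U`; evaluation at `u` recovers the one of
  -- `A u`, and `derivAt` gives its variation.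
  set B : Matrix (Fin n) (Fin n) (LaurentSeries (holoRing U)) := Matrix.of fun i j =>
    ∑ m ∈ Finset.range r, HahnSeries.single ((j : ℤ) - i - n * m)
      (toHolo (fun t => (A t i j).coeff m) (hA.holomorphic i j m)) with hB
  have hBev : ∀ (u : U) i j, (B i j).map (evalAt u) = shear (atInfinity (A u)) i j := by
    intro u i j
    rw [hB, Matrix.of_apply, shear_atInfinity_eq_sum (hA.gaugeFixed u u.2).degree]
    refine (map_laurent_sum (evalAt u : holoRing U →+ ℂ) _ _).trans ?_
    exact Finset.sum_congr rfl fun m _ =>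
      HahnSeries.map_single ((evalAt u : holoRing U →+ ℂ) : ZeroHom (holoRing U) ℂ)
  have hcoeff : ∀ (u : U) i j m, ((B i j).coeff m : U → ℂ) u =
      (shear (atInfinity (A u)) i j).coeff m := fun u i j m => by
    rw [← hBev]
    rfl
  have hτ : ∀ J, DifferentiableOn ℂ (fun t : Fin (r * n) → ℂ => time t J / (n : ℂ)) U := fun J => by
    simp only [div_eq_mul_inv]
    exact ((differentiable_time J).mul_const _).differentiableOn
  have hn : (n : ℂ) ≠ 0 := by exact_mod_cast NeZero.ne n
  obtain ⟨l, y, hly, hl, hl0, hy, hy0, hy1⟩ := PolyConn.exists_eigenrow isUnit_natCast_holoRing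
    (τ := toHolo _ (hτ (r * n - 1))) (τ' := toHolo _ (hτ (r * n)))
    (isUnit_toHolo _ fun u hu => div_ne_zero (hA.gaugeFixed u hu).lidskii hn)
    (N := (n : ℤ) - (r * n : ℕ)) B
    (fun i j m hm => by
      ext u
      rw [hcoeff]
      exact vanishBelow_shear_atInfinity hr (hA.gaugeFixed u u.2) i j m hm)
    (fun i j => by
      ext u
      rw [hcoeff, coeff_shear_atInfinity_first hr (hA.gaugeFixed u u.2)]
      split_ifs <;> rfl)
    (fun i j => by
      ext u
      rw [hcoeff, coeff_shear_atInfinity_second hr (hA.gaugeFixed u u.2)]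
      split_ifs <;> rfl)
  have hrow : ∀ u : U,
      IsEigenrow r (A u) u (fun j => (l j).map (evalAt u)) (y.map (evalAt u)) := by
    intro u
    refine ⟨fun j => ?_, fun j => (hl j).map (evalAt u : holoRing U →+ ℂ), fun j => ?_,
      hy.map (evalAt u : holoRing U →+ ℂ), ?_, ?_⟩
    · have h1 := congrArg (fun f => f.map (evalAt u : holoRing U →+ ℂ)) (hly j)
      simp only [map_laurent_sum] at h1
      have h2 : ∀ f g : LaurentSeries (holoRing U), (f * g).map (evalAt u : holoRing U →+ ℂ) =
        f.map (evalAt u) * g.map (evalAt u) := fun f g =>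
        map_laurent_mul (evalAt u) f g
      simp only [h2, hBev] at h1
      exact h1
    · rw [HahnSeries.map_coeff, hl0, map_one]
    · rw [HahnSeries.map_coeff, hy0]
      rfl
    · rw [HahnSeries.map_coeff, hy1]
      rfl
  refine ⟨l, y, hrow, fun u k K => ?_⟩
  set D := derivAt hU u (Pi.single k 1) with hD
  set T := deform (A u) (u : Fin (r * n) → ℂ) (k + 1) with hT
  set A' := T.map Polynomial.derivative + (T * A u - A u * T) with hA'
  have hA'coeff : ∀ i j m, fderiv ℂ (fun s => (A s i j).coeff m) u (Pi.single k 1) =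
      (A' i j).coeff m := fun i j m => hA.zeroCurvature u u.2 k i j m
  -- The degree bound is inherited from `A` by differentiating coefficients that vanish identically
  -- on the open set `U`, rather than read off from the commutator.
  have hdeg : ∀ i j m, r ≤ m → (A' i j).coeff m = 0 := by
    intro i j m hm
    rw [← hA'coeff]
    have : (fun s => (A s i j).coeff m) =ᶠ[nhds (u : Fin (r * n) → ℂ)] fun _ => 0 := by
      filter_upwards [hU.mem_nhds u.2] with s hs
      exact (hA.gaugeFixed s hs).degree i j m hm
    rw [this.fderiv_eq, fderiv_fun_const]
    rfl
  have hBD : ∀ i j, (B i j).map D = shear (atInfinity A') i j := by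
    intro i j
    rw [hB, Matrix.of_apply, shear_atInfinity_eq_sum hdeg, map_laurent_sum]
    refine Finset.sum_congr rfl fun m _ => ?_
    refine (HahnSeries.map_single (D : ZeroHom (holoRing U) ℂ)).trans ?_
    congr 1
    exact (derivAt_toHolo hU u _ _).trans (hA'coeff i j m)
  have hvar : ∀ j, ∑ i, ((l i).map D * shear (atInfinity (A u)) i j +
      (l i).map (evalAt u) * shear (atInfinity A') i j) =
        y.map D * (l j).map (evalAt u) + y.map (evalAt u) * (l j).map D := by
    intro j
    have h1 := congrArg (fun f => f.map D) (hly j)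
    have hleib := map_laurent_leibniz (ev := evalAt u) (D := D) (derivAt_mul hU u _)
    simp only [map_laurent_sum, hleib, hBev, hBD] at h1
    exact h1
  have h1 := (hrow u).trace_variation hvar K
  rw [hA', atInfinity_add, mul_add, Matrix.trace_add, (hrow u).trace_dressed_commutator,
    add_zero] at h1
  exact h1

omit [NeZero n] in
theorem residue_qPow_mul (K : ℕ) (y : LaurentSeries ℂ) :
    residue n (qPow K * y) = n * y.coeff (n + K) := by
  rw [residue, ← HahnSeries.single_zero_natCast, qPow, qPow, HahnSeries.single_mul_single, mul_one,
    mul_comm, ← mul_assoc, HahnSeries.single_mul_single, coeff_single_mul', mul_one]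
  congr 2
  ring

/-- Up to the symmetric factor `1/(JK)`, the derivative is the residue of `tr(M_K d(M_J)₊)`; its
antisymmetric part is the residue of `tr(𝓗^K d𝓗^J)`, which is zero. -/
theorem IsDeformation.hamiltonian_symm (hr : 2 ≤ r) (hU : IsOpen U) (hA : IsDeformation n r U A) :
    (∀ k : Fin (r * n), DifferentiableOn ℂ (fun t => hamiltonian (A t) t (k + 1)) U) ∧
      ∀ t ∈ U, ∀ j k : Fin (r * n),
        fderiv ℂ (fun t => hamiltonian (A t) t (k + 1)) t (Pi.single j 1) =
          fderiv ℂ (fun t => hamiltonian (A t) t (j + 1)) t (Pi.single k 1) := by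
  obtain ⟨l, y, hrow, hder⟩ := hA.exists_eigenrow hr hU
  have hham : ∀ k : Fin (r * n), Set.EqOn (fun t => hamiltonian (A t) t (k + 1))
      (fun t => (1 / ((k + 1 : ℕ) : ℂ) * n) * extendZero (y.coeff (n + (k + 1 : ℕ))) t) U := by
    intro k t ht
    simp only [hamiltonian]
    rw [(hrow ⟨t, ht⟩).spectralBranch_eq hr (hA.gaugeFixed t ht) (hA.hasTimes t ht),
      residue_qPow_mul, extendZero_apply _ ⟨t, ht⟩, mul_assoc]
    rfl
  refine ⟨fun k => ((differentiableOn_extendZero _).const_mul _).congr (hham k), ?_⟩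
  intro t ht
  have key : ∀ j k : Fin (r * n),
      fderiv ℂ (fun t => hamiltonian (A t) t (k + 1)) t (Pi.single j 1) =
        1 / ((k + 1 : ℕ) : ℂ) * (1 / ((j + 1 : ℕ) : ℂ) *
          (dressed (fun i => (l i).map (evalAt ⟨t, ht⟩)) (k + 1) *
            ((dressed (fun i => (l i).map (evalAt ⟨t, ht⟩)) (j + 1)).map nonnegPart).map
              ddx).trace.coeff 1) := by
    intro j k
    have h1 : fderiv ℂ (fun t => hamiltonian (A t) t (k + 1)) t =
        (1 / ((k + 1 : ℕ) : ℂ) * n) • fderiv ℂ (extendZero (y.coeff (n + (k + 1 : ℕ)))) t := by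
      rw [((hham k).eventuallyEq_of_mem (hU.mem_nhds ht)).fderiv_eq]
      exact fderiv_const_mul (differentiableAt_extendZero hU _ ⟨t, ht⟩) _
    have h2 := hder ⟨t, ht⟩ j (k + 1)
    rw [(hrow ⟨t, ht⟩).ddx_deform hr (hA.gaugeFixed t ht) (hA.hasTimes t ht)
      (Nat.succ_le_of_lt j.2), mul_laurent_smul, Matrix.trace_smul, smul_eq_mul,
      HahnSeries.C_apply, coeff_single_mul', sub_zero] at h2
    rw [h1, h2, smul_apply, smul_eq_mul, mul_assoc]
    rfl
  intro j k
  have hZ := (hrow ⟨t, ht⟩).isUnipotent.isUnit_det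
  have h3 := residue_trace_skew (dressed (fun i => (l i).map (evalAt ⟨t, ht⟩)) (k + 1))
    (dressed (fun i => (l i).map (evalAt ⟨t, ht⟩)) (j + 1))
  rw [dressed, dressed, trace_conj_mul_ddx (Matrix.nonsing_inv_mul _ hZ)
    (by rw [← pow_add, ← pow_add, add_comm]),
    residue_trace_bareH (Nat.succ_pos _) (Nat.succ_pos _), sub_eq_zero] at h3
  rw [key, key, dressed, dressed, h3]
  ring

end Deformation

end PolyConn
end

theorem mainTheorem9 (n r : ℕ) (hn : 1 ≤ n) (hr : 2 ≤ r) (U : Set (Fin (r * n) → ℂ)) (hU : IsOpen U)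
    (A : (Fin (r * n) → ℂ) → Matrix (Fin n) (Fin n) (Polynomial ℂ))
    (hA : PolyConn.IsDeformation n r U A) :
    PolyConn.IsClosedOn (PolyConn.tauForm A) U := by
  have : NeZero n := ⟨by omega⟩
  obtain ⟨hdiff, hsymm⟩ := hA.hamiltonian_symm hr hU
  have hd : ∀ t ∈ U, ∀ k : Fin (r * n),
      DifferentiableAt ℂ (fun t => PolyConn.hamiltonian (A t) t (k + 1)) t := fun t ht k =>
    (hdiff k).differentiableAt (hU.mem_nhds ht)
  have hder : ∀ t ∈ U, HasFDerivAt (PolyConn.tauForm A)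
      (∑ k : Fin (r * n), (fderiv ℂ (fun t => PolyConn.hamiltonian (A t) t (k + 1)) t).smulRight
        (ContinuousLinearMap.proj (R := ℂ) (φ := fun _ : Fin (r * n) => ℂ) k)) t := by
    intro t ht
    refine HasFDerivAt.fun_sum fun k _ => ?_
    exact (hd t ht k).hasFDerivAt.smul_const
      (ContinuousLinearMap.proj (R := ℂ) (φ := fun _ : Fin (r * n) => ℂ) k)
  refine ⟨fun t ht => (hder t ht).differentiableAt.differentiableWithinAt, ?_⟩
  intro t ht u v
  -- The differential as a bilinear form in `u, v`, whose matrix is symmetric by `hsymm`.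
  have expand : ∀ u v : Fin (r * n) → ℂ, fderiv ℂ (PolyConn.tauForm A) t u v =
      ∑ k, ∑ j, u j * v k *
        fderiv ℂ (fun t => PolyConn.hamiltonian (A t) t (k + 1)) t (Pi.single j 1) := by
    intro u v
    rw [(hder t ht).fderiv]
    simp only [sum_apply, ContinuousLinearMap.smulRight_apply,
      smul_apply, ContinuousLinearMap.proj_apply, smul_eq_mul]
    refine Finset.sum_congr rfl fun k _ => ?_
    conv_lhs => rw [pi_eq_sum_univ' u]
    simp only [map_sum, map_smul, smul_eq_mul, Finset.sum_mul]
    refine Finset.sum_congr rfl fun j _ => ?_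
    ring
  rw [expand, expand, Finset.sum_comm, sub_eq_zero]
  refine Finset.sum_congr rfl fun j _ => Finset.sum_congr rfl fun k _ => ?_
  rw [hsymm t ht j k]
  ring
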